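/- Let $k$ be a field of characteristic different from $2$ and $3$, let $E/k$ be an elliptic curve given by a Weierstrass equation in coordinates $x,y$ with point at infinity $P_\infty$, and let $\ell$ be a prime different from the characteristic of $k$. Let $E[\ell]$ denote the group of all $\ell$-torsion points of $E$ over an algebraic closure of $k$, and assume that $E[\ell]=\langle W_1,W_2\rangle$ with $W_1,W_2\in E(k)$. For $i=1,2$ let $h_{W_i}\in k[E]=k[x,y]$ be the polynomial function on $E$ with divisor $\operatorname{div}(h_{W_i})=\ell W_i-\ell P_\infty$, normalized at infinity so that, when $h_{W_i}$ is written in the form $p(x)+q(x)\,y$ with $p,q\in k[x]$, the coefficient of $x^{(\ell-3)/2}y$ is $1$ if $\ell$ is odd, and the coefficient of $x$ is $1$ if $\ell=2$. Let $Q\in E(k)$ with $Q\neq P_\infty$. (a) If there exists $P\in E(k)$ with $\ell P=Q$, then $h_{W_1}(-Q)$ and $h_{W_2}(-Q)$ are $\ell$-th powers in $k$ (where $0=0^\ell$ counts as an $\ell$-th power). (b) If moreover $Q\neq -W_1$ and $Q\neq -W_2$ (that is, $h_{W_1}(-Q)$ and $h_{W_2}(-Q)$ are nonzero), then there exists $P\in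 E(k)$ with $\ell P=Q$ if and only if $h_{W_1}(-Q)$ and $h_{W_2}(-Q)$ are $\ell$-th powers in $k$. -/

import Mathlib

open Polynomial

namespace EllipticDivision

noncomputable section

variable {k : Type*} [Field k]

/-! ### The full `ℓ`-torsion -/

/-- The inclusion `E(k) → E(K)` of rational points, for a field extension `K / k`. -/
def extendPoint (E : WeierstrassCurve k) (K : Type*) [Field K] [Algebra k K] :
    E.toAffine.Point → (E.map (algebraMap k K)).toAffine.Point
  | .zero => .zero
  | .some x y h => .some (algebraMap k K x) (algebraMap k K y)
      ((E.toAffine.map_nonsingular (algebraMap k K).injective x y).mpr h)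

open scoped Classical in
/-- `E[ℓ] = ⟨W₁, W₂⟩`, where `E[ℓ]` is the group of all `ℓ`-torsion points of `E` over an algebraic
closure of `k`, and `W₁, W₂` are `k`-rational points. -/
def TorsionGeneratedBy (E : WeierstrassCurve k) (ℓ : ℕ) (W₁ W₂ : E.toAffine.Point) : Prop :=
  ∀ T : (E.map (algebraMap k (AlgebraicClosure k))).toAffine.Point,
    ℓ • T = 0 ↔ T ∈ AddSubgroup.closure
      {extendPoint E (AlgebraicClosure k) W₁, extendPoint E (AlgebraicClosure k) W₂}

/-! ### Divisors of polynomial functions -/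

/-- The closed points of the projective curve `E` over `k`: the maximal ideals of the affine
coordinate ring `k[E]`, together with the point at infinity `none`. -/
abbrev ClosedPoint (E : WeierstrassCurve k) : Type _ :=
  Option (MaximalSpectrum E.toAffine.CoordinateRing)

/-- The ideal `⟨x - x₀, y - y₀⟩` of an affine point `(x₀, y₀)` of `E(k)` is maximal. -/
theorem isMaximal_XYIdeal (E : WeierstrassCurve k) {x y : k} (h : E.toAffine.Equation x y) :
    (WeierstrassCurve.Affine.CoordinateRing.XYIdeal E.toAffine x (C y)).IsMaximal :=
  Ideal.Quotient.maximal_of_isField _ <|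
    (WeierstrassCurve.Affine.CoordinateRing.quotientXYIdealEquiv
      (W' := E.toAffine) (x := x) (y := C y) h).toMulEquiv.isField (Field.toIsField k)

/-- The closed point given by a rational point of `E`. -/
def closedPoint (E : WeierstrassCurve k) : E.toAffine.Point → ClosedPoint E
  | .zero => none
  | .some x y h =>
      some ⟨WeierstrassCurve.Affine.CoordinateRing.XYIdeal E.toAffine x (C y),
        isMaximal_XYIdeal E h.1⟩

/-- The polynomial `p` in the unique expression `f = p(x) + q(x) y` of `f ∈ k[E]`. -/
def xPart (E : WeierstrassCurve k) (f : E.toAffine.CoordinateRing) : k[X] :=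
  (WeierstrassCurve.Affine.CoordinateRing.basis E.toAffine).repr f 0

/-- The polynomial `q` in the unique expression `f = p(x) + q(x) y` of `f ∈ k[E]`. -/
def yPart (E : WeierstrassCurve k) (f : E.toAffine.CoordinateRing) : k[X] :=
  (WeierstrassCurve.Affine.CoordinateRing.basis E.toAffine).repr f 1

/-- The order of the pole at infinity of a nonzero `f = p(x) + q(x) y`: as `x` and `y` have poles of
orders `2` and `3` there, the poles of `p(x)` and of `q(x) y` have orders of different parity.
(Here `p = 0` or `q = 0` contributes `⊥`, and the junk value at `f = 0` is `0`.) -/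
def poleOrder (E : WeierstrassCurve k) (f : E.toAffine.CoordinateRing) : ℕ :=
  (max (2 • (xPart E f).degree) (2 • (yPart E f).degree + 3)).unbotD 0

/-- The order of a nonzero polynomial function `f ∈ k[E]` at a closed point of `E`. -/
def ord (E : WeierstrassCurve k) (f : E.toAffine.CoordinateRing) : ClosedPoint E → ℤ
  | none => -(poleOrder E f : ℤ)
  | some M => ((sSup {n : ℕ | f ∈ M.asIdeal ^ n} : ℕ) : ℤ)

/-- `div f = D`, for a polynomial function `f` and a divisor `D` on `E`. -/
def HasDivisor (E : WeierstrassCurve k) (f : E.toAffine.CoordinateRing)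
    (D : ClosedPoint E →₀ ℤ) : Prop :=
  f ≠ 0 ∧ ∀ v, ord E f v = D v

/-- `h` is the function `h_W`: it has divisor `ℓ W - ℓ P_∞`, and it is normalized at infinity, i.e.
the term of `h` with a pole of order `ℓ` at infinity (namely `x ^ ((ℓ - 3) / 2) * y` if `ℓ` is odd,
and `x` if `ℓ = 2`) has coefficient `1`. -/
structure IsMillerFunction (E : WeierstrassCurve k) (ℓ : ℕ) (W : E.toAffine.Point)
    (h : E.toAffine.CoordinateRing) : Prop where
  hasDivisor : HasDivisor E h
    (Finsupp.single (closedPoint E W) (ℓ : ℤ) - Finsupp.single (closedPoint E 0) (ℓ : ℤ))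
  normalized : if ℓ = 2 then (xPart E h).coeff 1 = 1 else (yPart E h).coeff ((ℓ - 3) / 2) = 1

/-- The value `f(P)` of a polynomial function `f ∈ k[E]` at a point `P ≠ P_∞` of `E(k)`. -/
def value (E : WeierstrassCurve k) (f : E.toAffine.CoordinateRing) :
    (P : E.toAffine.Point) → P ≠ 0 → k
  | .zero, hP => absurd rfl hP
  | .some _ _ h, _ => AdjoinRoot.evalEval h.1 f

end

end EllipticDivision

/-! For an `ℓ`-torsion point W ≠ 0 let h_W (`torsFun`) have zeros ℓ(W), and for P with ℓP ≠ 0 let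
f_P (`divFun`) have zeros ℓ(P) + (-ℓP), both with leading coefficient 1 at infinity. Weil
reciprocity (`IsFun.reciprocity`) gives f_P(W)^ℓ = h_W(P)^ℓ h_W(-ℓP). So κ_W(P) = f_P(W) / h_W(P)
(`kummer`) is an `ℓ`-th root of h_W(-ℓP) in any field over which P and W are defined. This is (a),
zero values included.

Reciprocity itself is elementary. Along a closed walk in the group, a function with given zeros is a
product of lines divided by a product of vertical lines (`IsFun.mul_prod_vert`), so everything
reduces to two lines, or a line and a vertical line, where it is a computation with the Weierstrass
equation.

For the converse in (b), choose P over the algebraic closure with ℓP = Q. Translating P by a torsion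
point T multiplies κ_W(P) by a constant e(T, W), the Weil pairing (`translates_pairing`). It is
alternating (`translates_self`), and nontrivial if W and T generate the torsion (`pairing_ne_one`):
otherwise κ_W at an `ℓ`-division point of minus the generic point would be Galois invariant, and h_W
would be an `ℓ`-th power in the function field, although no function has a single simple pole. Hence
k contains a primitive `ℓ`-th root of unity, and if the h_{W_i}(-Q) are `ℓ`-th powers, both
κ_{W_i}(P) lie in k. An automorphism σ sends P to P + aW₁ + bW₂ and multiplies these two values by
e(W₂, W₁)^b and e(W₁, W₂)^a; so `ℓ` divides a and b, and σ fixes P.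

A fixed point is rational once its coordinates are separable over k. This comes from the rational
function A / B of degree ℓ² describing multiplication by `ℓ` on abscissas (`exists_isMulPair`),
which also yields division points and the ℓ² torsion points over the closure. -/

namespace EllipticDivision

open WeierstrassCurve.Affine
open scoped Classical Polynomial.Bivariate

noncomputable section

section

variable {F : Type*} [Field F] {V : WeierstrassCurve.Affine F}

/-! ### Evaluation at points and ideals of points -/

/-- The first coordinate of a point, with junk value `0` at infinity. -/
def xCoord : V.Point → F
  | .zero => 0
  | .some x _ _ => x

/-- The second coordinate of a point, with junk value `0` at infinity. -/
def yCoord : V.Point → F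
  | .zero => 0
  | .some _ y _ => y

/-- Evaluation at a point; by convention the value at infinity is `1`. -/
def val : V.Point → (V.CoordinateRing →* F)
  | .zero => 1
  | .some _ _ h => (AdjoinRoot.evalEval h.1 : V.CoordinateRing →+* F).toMonoidHom

/-- The ideal of functions vanishing at a point; by convention it is the unit ideal at infinity. -/
def pointIdeal : V.Point → Ideal V.CoordinateRing
  | .zero => ⊤
  | .some x y _ => CoordinateRing.XYIdeal V x (C y)

/-- The vertical line through a point. -/
def vert (P : V.Point) : V.CoordinateRing := CoordinateRing.XClass V (xCoord P)

/-- The polynomial defining the line through two points, or the tangent line. -/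
def linePoly (P Q : V.Point) : F[X] :=
  linePolynomial (xCoord P) (yCoord P) (V.slope (xCoord P) (xCoord Q) (yCoord P) (yCoord Q))

/-- The line through two points, or the tangent line. -/
def line (P Q : V.Point) : V.CoordinateRing := CoordinateRing.YClass V (linePoly P Q)

lemma val_mk {x y : F} (h : V.Nonsingular x y) (p : F[X][Y]) :
    val (.some x y h) (CoordinateRing.mk V p) = p.evalEval x y :=
  AdjoinRoot.evalEval_mk h.1 p

lemma val_smul_basis {P : V.Point} (hP : P ≠ 0) (p q : F[X]) :
    val P (p • 1 + q • CoordinateRing.mk V Y) =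
      p.eval (xCoord P) + q.eval (xCoord P) * yCoord P := by
  rcases P with _ | ⟨x, y, h⟩
  · exact absurd rfl hP
  · rw [CoordinateRing.smul, CoordinateRing.smul, mul_one, ← map_mul, ← map_add, val_mk]
    simp [xCoord, yCoord, evalEval_C]

lemma val_vert {P : V.Point} (Q : V.Point) (hP : P ≠ 0) :
    val P (vert Q) = xCoord P - xCoord Q := by
  rcases P with _ | ⟨x, y, h⟩
  · exact absurd rfl hP
  · rw [vert, CoordinateRing.XClass, val_mk]
    simp [xCoord, evalEval_C]

lemma val_line {P : V.Point} (Q R : V.Point) (hP : P ≠ 0) :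
    val P (line Q R) = yCoord P - (linePoly Q R).eval (xCoord P) := by
  rcases P with _ | ⟨x, y, h⟩
  · exact absurd rfl hP
  · rw [line, CoordinateRing.YClass, val_mk]
    simp [xCoord, yCoord, evalEval_C]

lemma mem_pointIdeal {P : V.Point} (hP : P ≠ 0) {f : V.CoordinateRing} :
    f ∈ pointIdeal P ↔ val P f = 0 := by
  rcases P with _ | ⟨x, y, h⟩
  · exact absurd rfl hP
  have hle : pointIdeal (.some x y h) ≤ RingHom.ker (AdjoinRoot.evalEval h.1) := by
    rw [pointIdeal, CoordinateRing.XYIdeal, Ideal.span_le]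
    rintro g (rfl | rfl)
    · exact (val_mk h _).trans (by simp [evalEval_C])
    · exact (val_mk h _).trans (by simp [evalEval_C])
  have hmax : (pointIdeal (.some x y h)).IsMaximal := isMaximal_XYIdeal V h.1
  have := hmax.eq_of_le (RingHom.ker_ne_top _) hle
  rw [this, RingHom.mem_ker]
  rfl

lemma isMaximal_pointIdeal {P : V.Point} (hP : P ≠ 0) : (pointIdeal P).IsMaximal := by
  rcases P with _ | ⟨x, y, h⟩
  · exact absurd rfl hP
  · exact isMaximal_XYIdeal V h.1

lemma pointIdeal_neg_mul {P : V.Point} (hP : P ≠ 0) :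
    pointIdeal (-P) * pointIdeal P = Ideal.span {vert P} := by
  rcases P with _ | ⟨x, y, h⟩
  · exact absurd rfl hP
  · exact CoordinateRing.XYIdeal_neg_mul h

lemma vert_ne_zero (P : V.Point) : vert P ≠ 0 := CoordinateRing.XClass_ne_zero _

/-- Point ideals are invertible: the ideal of `-P` turns the factor into the principal ideal of a
vertical line, which cancels in a domain. -/
lemma pointIdeal_mul_left_cancel (P : V.Point) {I J : Ideal V.CoordinateRing}
    (h : pointIdeal P * I = pointIdeal P * J) : I = J := by
  by_cases hP : P = 0
  · subst hP; simpa [pointIdeal, Point.zero_def, Ideal.top_mul] using h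
  have := congr_arg (pointIdeal (-P) * ·) h
  simp only [← mul_assoc, pointIdeal_neg_mul hP] at this
  exact (Ideal.span_singleton_mul_right_inj (vert_ne_zero P)).mp this

lemma neg_some_eq_iff {x₁ y₁ x₂ y₂ : F} (h₁ : V.Nonsingular x₁ y₁) (h₂ : V.Nonsingular x₂ y₂) :
    (x₁ = x₂ ∧ y₁ = V.negY x₂ y₂) ↔ Point.some x₁ y₁ h₁ + .some x₂ y₂ h₂ = 0 := by
  constructor
  · rintro ⟨h, h'⟩; exact Point.add_of_Y_eq h h'
  · intro h; by_contra hxy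
    rw [Point.add_some hxy] at h
    exact Point.some_ne_zero _ h

lemma vert_add_mul_pointIdeal_mul {P Q : V.Point} (hP : P ≠ 0) (hQ : Q ≠ 0) (hPQ : P + Q ≠ 0) :
    Ideal.span {vert (P + Q)} * (pointIdeal P * pointIdeal Q) =
      Ideal.span {line P Q} * pointIdeal (P + Q) := by
  rcases P with _ | ⟨x, y, h⟩
  · exact absurd rfl hP
  rcases Q with _ | ⟨x', y', h'⟩
  · exact absurd rfl hQ
  have hxy := mt (neg_some_eq_iff h h').mp hPQ
  rw [Point.add_some hxy]
  exact CoordinateRing.XYIdeal_mul_XYIdeal h.1 h'.1 hxy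

/-- The divisor of a line. -/
lemma pointIdeal_mul_mul {P Q : V.Point} (hP : P ≠ 0) (hQ : Q ≠ 0) (hPQ : P + Q ≠ 0) :
    pointIdeal P * pointIdeal Q * pointIdeal (-(P + Q)) = Ideal.span {line P Q} := by
  have h := vert_add_mul_pointIdeal_mul hP hQ hPQ
  rw [← pointIdeal_neg_mul hPQ] at h
  apply pointIdeal_mul_left_cancel (P + Q)
  rw [mul_comm (pointIdeal (P + Q)) (Ideal.span _), ← h]
  simp only [mul_comm, mul_left_comm]

/-! ### Reciprocity for two lines -/

lemma eval_linePoly {P Q : V.Point} (hP : P ≠ 0) (hQ : Q ≠ 0) (hPQ : P + Q ≠ 0) :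
    (linePoly P Q).eval (xCoord P) = yCoord P ∧ (linePoly P Q).eval (xCoord Q) = yCoord Q ∧
      (linePoly P Q).eval (xCoord (-(P + Q))) = yCoord (-(P + Q)) := by
  have hl := pointIdeal_mul_mul hP hQ hPQ
  have hm : line P Q ∈ pointIdeal P * pointIdeal Q * pointIdeal (-(P + Q)) := by
    rw [hl]; exact Ideal.mem_span_singleton_self _
  have h3 := Ideal.mul_le_right hm
  have h12 := Ideal.mul_le_left hm
  have h1 := Ideal.mul_le_left h12
  have h2 := Ideal.mul_le_right h12
  rw [mem_pointIdeal hP, val_line _ _ hP] at h1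
  rw [mem_pointIdeal hQ, val_line _ _ hQ] at h2
  rw [mem_pointIdeal (neg_ne_zero.mpr hPQ), val_line _ _ (neg_ne_zero.mpr hPQ)] at h3
  exact ⟨(sub_eq_zero.mp h1).symm, (sub_eq_zero.mp h2).symm, (sub_eq_zero.mp h3).symm⟩

/-- Substituting a line into the Weierstrass equation leaves a cubic whose roots are the abscissas
of the three intersection points. Both reciprocity laws for lines are evaluations of this identity.
-/
lemma evalEval_linePoly {P Q : V.Point} (hP : P ≠ 0) (hQ : Q ≠ 0) (hPQ : P + Q ≠ 0) (t : F) :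
    V.polynomial.evalEval t ((linePoly P Q).eval t) =
      -((t - xCoord P) * (t - xCoord Q) * (t - xCoord (-(P + Q)))) := by
  rcases P with _ | ⟨x, y, h⟩
  · exact absurd rfl hP
  rcases Q with _ | ⟨x', y', h'⟩
  · exact absurd rfl hQ
  have hxy := mt (neg_some_eq_iff h h').mp hPQ
  have := congr_arg (eval t) (addPolynomial_slope h.1 h'.1 hxy)
  rw [Point.add_some hxy, Point.neg_some]
  simp only [eval_neg, eval_mul, eval_sub, eval_X, eval_C] at this
  simp only [xCoord]
  rw [← this, addPolynomial, evalEval, linePoly]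
  simp only [xCoord, yCoord, polynomial]
  simp

lemma linePoly_eq (P Q : V.Point) : ∃ m c : F, linePoly P Q = C m * X + C c := by
  refine ⟨V.slope (xCoord P) (xCoord Q) (yCoord P) (yCoord Q),
    -V.slope (xCoord P) (xCoord Q) (yCoord P) (yCoord Q) * xCoord P + yCoord P, ?_⟩
  rw [linePoly, linePolynomial]
  simp only [map_add, map_mul, map_neg]
  ring

/-- Let the lines have slopes `m ≠ m'` and meet at abscissa `t`. Every value on the left is `m - m'`
times an abscissa minus `t`, and on the right `m' - m` takes the place of `m - m'`. The products of
the remaining factors agree, both being the Weierstrass polynomial at the meeting point; the sign is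
that of three slope differences. -/
lemma line_line_reciprocity {P Q P' Q' : V.Point} (hP : P ≠ 0) (hQ : Q ≠ 0) (hPQ : P + Q ≠ 0)
    (hP' : P' ≠ 0) (hQ' : Q' ≠ 0) (hPQ' : P' + Q' ≠ 0) :
    val P (line P' Q') * val Q (line P' Q') * val (-(P + Q)) (line P' Q') =
      -(val P' (line P Q) * val Q' (line P Q) * val (-(P' + Q')) (line P Q)) := by
  have e := evalEval_linePoly hP hQ hPQ
  have e' := evalEval_linePoly hP' hQ' hPQ'
  rw [val_line _ _ hP, val_line _ _ hQ, val_line _ _ (neg_ne_zero.mpr hPQ), val_line _ _ hP',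
    val_line _ _ hQ', val_line _ _ (neg_ne_zero.mpr hPQ'), ← (eval_linePoly hP hQ hPQ).1,
    ← (eval_linePoly hP hQ hPQ).2.1, ← (eval_linePoly hP hQ hPQ).2.2,
    ← (eval_linePoly hP' hQ' hPQ').1, ← (eval_linePoly hP' hQ' hPQ').2.1,
    ← (eval_linePoly hP' hQ' hPQ').2.2]
  obtain ⟨m, c, h⟩ := linePoly_eq P Q
  obtain ⟨m', c', h'⟩ := linePoly_eq P' Q'
  rw [h] at e ⊢
  rw [h'] at e' ⊢
  generalize xCoord P = a at *
  generalize xCoord Q = b at *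
  generalize xCoord (-(P + Q)) = d at *
  generalize xCoord P' = a' at *
  generalize xCoord Q' = b' at *
  generalize xCoord (-(P' + Q')) = d' at *
  simp only [eval_add, eval_mul, eval_C, eval_X] at *
  -- For parallel lines all six factors are the constant `c - c'` up to sign.
  by_cases hm : m = m'
  · subst hm; ring
  · have hm' : m - m' ≠ 0 := sub_ne_zero.mpr hm
    set t := -(c - c') / (m - m') with ht
    have htt : m * t + c = m' * t + c' := by rw [ht]; field_simp; ring
    have hc : c - c' = -(m - m') * t := by rw [ht]; field_simp
    have key := (e t).symm.trans ((congr_arg (V.polynomial.evalEval t) htt).trans (e' t))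
    have hc' : c = c' - (m - m') * t := by linear_combination hc
    rw [hc']
    linear_combination (m - m') ^ 3 * key

/-- The ordinates of `S` and `-S` are the two roots in `Y` of the Weierstrass polynomial at that
abscissa, so the left side is its value at the point of the line above `S`. -/
lemma line_vert_reciprocity {P Q S : V.Point} (hP : P ≠ 0) (hQ : Q ≠ 0) (hPQ : P + Q ≠ 0)
    (hS : S ≠ 0) :
    val S (line P Q) * val (-S) (line P Q) =
      val P (vert S) * val Q (vert S) * val (-(P + Q)) (vert S) := by
  have e := evalEval_linePoly hP hQ hPQ (xCoord S)
  rw [val_vert _ hP, val_vert _ hQ, val_vert _ (neg_ne_zero.mpr hPQ), val_line _ _ hS,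
    val_line _ _ (neg_ne_zero.mpr hS)]
  rcases S with _ | ⟨x, y, h⟩
  · exact absurd rfl hS
  rw [Point.neg_some]
  have h1 := (equation_iff' ..).mp h.1
  rw [evalEval_polynomial] at e
  simp only [xCoord.eq_2, yCoord.eq_2, negY] at *
  linear_combination e - h1

end

section

variable {F : Type*} [Field F] {V : WeierstrassCurve.Affine F}

/-! ### Functions with leading coefficient one at infinity -/

/-- The function `f` has a pole of order `n` at infinity, with leading coefficient `1`. -/
def MonicAt (f : V.CoordinateRing) (n : ℕ) : Prop :=
  ∃ (m : ℕ) (p q : F[X]), f = p • (1 : V.CoordinateRing) + q • CoordinateRing.mk V Y ∧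
    ((n = 2 * m ∧ p.Monic ∧ p.natDegree = m ∧ (q = 0 ∨ q.natDegree + 2 ≤ m)) ∨
      (n = 2 * m + 3 ∧ q.Monic ∧ q.natDegree = m ∧ p.natDegree ≤ m + 1))

lemma smul_basis_inj {p q p' q' : F[X]}
    (h : p • (1 : V.CoordinateRing) + q • CoordinateRing.mk V Y =
      p' • (1 : V.CoordinateRing) + q' • CoordinateRing.mk V Y) : p = p' ∧ q = q' := by
  have : (p - p') • (1 : V.CoordinateRing) + (q - q') • CoordinateRing.mk V Y = 0 := by
    rw [sub_smul, sub_smul]; linear_combination h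
  obtain ⟨h1, h2⟩ := CoordinateRing.smul_basis_eq_zero this
  exact ⟨sub_eq_zero.mp h1, sub_eq_zero.mp h2⟩

lemma smul_basis_mul (p q r s : F[X]) :
    (p • (1 : V.CoordinateRing) + q • CoordinateRing.mk V Y) *
      (r • (1 : V.CoordinateRing) + s • CoordinateRing.mk V Y) =
    (p * r + q * s * (X ^ 3 + C V.a₂ * X ^ 2 + C V.a₄ * X + C V.a₆)) • (1 : V.CoordinateRing) +
      (p * s + q * r - q * s * (C V.a₁ * X + C V.a₃)) • CoordinateRing.mk V Y := by
  have h := CoordinateRing.smul_basis_mul_Y (W' := V) p q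
  have h' := CoordinateRing.smul_basis_mul_C (W' := V) r p q
  have h'' := CoordinateRing.smul_basis_mul_C (W' := V) s
    (q * (X ^ 3 + C V.a₂ * X ^ 2 + C V.a₄ * X + C V.a₆)) (p - q * (C V.a₁ * X + C V.a₃))
  rw [← h] at h''
  rw [mul_add, CoordinateRing.smul r, CoordinateRing.smul s, mul_one, h',
    mul_comm (CoordinateRing.mk V (C s)), ← mul_assoc, h'']
  simp only [add_smul, sub_smul, mul_smul, sub_mul]
  simp only [CoordinateRing.smul]
  ring

lemma monic_add_of_natDegree_lt {p t : F[X]} {N : ℕ} (hp : p.Monic) (hN : p.natDegree = N)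
    (ht : t = 0 ∨ t.natDegree < N) : (p + t).Monic ∧ (p + t).natDegree = N := by
  have : t.degree < p.degree := by
    rcases ht with rfl | ht
    · rw [degree_zero, bot_lt_iff_ne_bot]
      exact degree_ne_bot.mpr hp.ne_zero
    · exact degree_lt_degree (hN ▸ ht)
  exact ⟨hp.add_of_left this, by rw [natDegree_add_eq_left_of_degree_lt this, hN]⟩

lemma natDegree_cubic_le (V : WeierstrassCurve.Affine F) :
    (X ^ 3 + C V.a₂ * X ^ 2 + C V.a₄ * X + C V.a₆ : F[X]).natDegree ≤ 3 := by
  compute_degree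

lemma natDegree_linear_le' (V : WeierstrassCurve.Affine F) :
    (C V.a₁ * X + C V.a₃ : F[X]).natDegree ≤ 1 := by
  compute_degree

lemma cubic_monic (V : WeierstrassCurve.Affine F) :
    (X ^ 3 + C V.a₂ * X ^ 2 + C V.a₄ * X + C V.a₆ : F[X]).Monic ∧
    (X ^ 3 + C V.a₂ * X ^ 2 + C V.a₄ * X + C V.a₆ : F[X]).natDegree = 3 := by
  constructor
  · monicity!
  · compute_degree!

/-- The four cases are the parities of the two pole orders. When both are odd the leading term comes
from `Y ^ 2`, which contributes the monic cubic in `X`. -/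
lemma MonicAt.mul {f g : V.CoordinateRing} {n n' : ℕ} (hf : MonicAt f n) (hg : MonicAt g n') :
    MonicAt (f * g) (n + n') := by
  obtain ⟨m, p, q, rfl, h⟩ := hf
  obtain ⟨k, r, s, rfl, h'⟩ := hg
  rw [smul_basis_mul]
  have hc := natDegree_cubic_le V
  have hl := natDegree_linear_le' V
  have hcm := cubic_monic V
  set c : F[X] := X ^ 3 + C V.a₂ * X ^ 2 + C V.a₄ * X + C V.a₆
  set l : F[X] := C V.a₁ * X + C V.a₃
  have bd (u v : F[X]) : (u * v).natDegree ≤ u.natDegree + v.natDegree := natDegree_mul_le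
  have sub3 (u v w : F[X]) (d : ℕ) (h1 : u.natDegree ≤ d) (h2 : v.natDegree ≤ d)
      (h3 : w.natDegree ≤ d) : (u + v - w).natDegree ≤ d :=
    (natDegree_sub_le_of_le (natDegree_add_le_of_degree_le h1 h2) h3).trans (max_self d).le
  rcases h with ⟨rfl, hp, hpm, hq⟩ | ⟨rfl, hq, hqm, hp⟩ <;>
    rcases h' with ⟨rfl, hr, hrk, hs⟩ | ⟨rfl, hs, hsk, hr⟩
  · refine ⟨m + k, _, _, rfl, Or.inl ⟨by ring, ?_⟩⟩
    have h1 := monic_add_of_natDegree_lt (t := q * s * c) (hp.mul hr)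
      ((hp.natDegree_mul hr).trans (by rw [hpm, hrk])) (by
        rcases hq with rfl | hq
        · simp
        rcases hs with rfl | hs
        · simp
        have := bd (q * s) c; have := bd q s
        right; omega)
    refine ⟨h1.1, h1.2, ?_⟩
    rcases hq with rfl | hq <;> rcases hs with rfl | hs
    · simp
    · right
      have := bd p s
      simp only [zero_mul, add_zero, sub_zero]; omega
    · right
      have := bd q r
      simp only [zero_mul, mul_zero, zero_add, sub_zero]; omega
    · right
      have := sub3 (p * s) (q * r) (q * s * l) (m + k - 2)
        (by have := bd p s; omega) (by have := bd q r; omega)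
        (by have := bd (q * s) l; have := bd q s; omega)
      omega
  · refine ⟨m + k, _, _, rfl, Or.inr ⟨by ring, ?_⟩⟩
    have h1 := monic_add_of_natDegree_lt (t := q * r - q * s * l) (hp.mul hs)
      ((hp.natDegree_mul hs).trans (by rw [hpm, hsk])) (by
        rcases hq with rfl | hq
        · simp
        right
        have := sub3 (q * r) 0 (q * s * l) (m + k - 1)
          (by have := bd q r; omega) (by simp) (by have := bd (q * s) l; have := bd q s; omega)
        rw [add_zero] at this
        omega)
    rw [← add_sub_assoc] at h1
    refine ⟨h1.1, h1.2, ?_⟩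
    refine natDegree_add_le_of_degree_le (by have := bd p r; omega) ?_
    rcases hq with rfl | hq
    · simp
    · have := bd (q * s) c; have := bd q s; omega
  · refine ⟨m + k, _, _, rfl, Or.inr ⟨by ring, ?_⟩⟩
    have h1 := monic_add_of_natDegree_lt (t := p * s - q * s * l) (hq.mul hr)
      ((hq.natDegree_mul hr).trans (by rw [hqm, hrk])) (by
        rcases hs with rfl | hs
        · simp
        right
        have := sub3 (p * s) 0 (q * s * l) (m + k - 1)
          (by have := bd p s; omega) (by simp) (by have := bd (q * s) l; have := bd q s; omega)
        rw [add_zero] at this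
        omega)
    rw [← add_sub_assoc, add_comm (q * r)] at h1
    refine ⟨h1.1, h1.2, ?_⟩
    refine natDegree_add_le_of_degree_le (by have := bd p r; omega) ?_
    rcases hs with rfl | hs
    · simp
    · have := bd (q * s) c; have := bd q s; omega
  · refine ⟨m + k + 3, _, _, rfl, Or.inl ⟨by ring, ?_⟩⟩
    have h1 := monic_add_of_natDegree_lt (t := p * r) ((hq.mul hs).mul hcm.1)
      (((hq.mul hs).natDegree_mul hcm.1).trans
        (by rw [hq.natDegree_mul hs, hqm, hsk, hcm.2]))
      (by right; have := bd p r; omega)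
    rw [add_comm] at h1
    refine ⟨h1.1, h1.2, Or.inr ?_⟩
    have := sub3 (p * s) (q * r) (q * s * l) (m + k + 1)
        (by have := bd p s; omega) (by have := bd q r; omega)
        (by have := bd (q * s) l; have := bd q s; omega)
    omega

lemma monicAt_one : MonicAt (1 : V.CoordinateRing) 0 :=
  ⟨0, 1, 0, by simp, Or.inl ⟨rfl, monic_one, natDegree_one, Or.inl rfl⟩⟩

lemma monicAt_vert (P : V.Point) : MonicAt (vert P) 2 :=
  ⟨1, X - C (xCoord P), 0, by rw [CoordinateRing.smul]; simp [vert, CoordinateRing.XClass],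
    Or.inl ⟨rfl, monic_X_sub_C _, natDegree_X_sub_C _, Or.inl rfl⟩⟩

lemma monicAt_line (P Q : V.Point) : MonicAt (line P Q) 3 := by
  refine ⟨0, -linePoly P Q, 1, ?_, Or.inr ⟨rfl, monic_one, natDegree_one, ?_⟩⟩
  · rw [CoordinateRing.smul, CoordinateRing.smul]
    simp only [line, CoordinateRing.YClass, map_sub, map_neg, map_one]
    ring
  · obtain ⟨m, c, h⟩ := linePoly_eq P Q
    rw [natDegree_neg, h]
    compute_degree

lemma MonicAt.prod {f : ℕ → V.CoordinateRing} {d : ℕ} (n : ℕ)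
    (h : ∀ i < n, MonicAt (f i) d) : MonicAt (∏ i ∈ Finset.range n, f i) (n * d) := by
  induction n with
  | zero => simpa using monicAt_one
  | succ n ih =>
    rw [Finset.prod_range_succ, Nat.succ_mul]
    exact (ih fun i hi => h i (by omega)).mul (h n (by omega))

lemma MonicAt.pow {f : V.CoordinateRing} {d : ℕ} (h : MonicAt f d) (n : ℕ) :
    MonicAt (f ^ n) (n * d) := by
  simpa using MonicAt.prod (f := fun _ => f) n fun _ _ => h

lemma MonicAt.ne_zero {f : V.CoordinateRing} {n : ℕ} (h : MonicAt f n) : f ≠ 0 := by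
  rintro rfl
  obtain ⟨m, p, q, hf, h⟩ := h
  obtain ⟨rfl, rfl⟩ := CoordinateRing.smul_basis_eq_zero hf.symm
  rcases h with ⟨_, h, _⟩ | ⟨_, h, _⟩ <;> exact h.ne_zero rfl

lemma natDegree_norm_smul_basis (p q : F[X]) (hq : q ≠ 0) :
    (Algebra.norm F[X] (p • (1 : V.CoordinateRing) + q • CoordinateRing.mk V Y)).natDegree =
      max (2 * p.natDegree) (2 * q.natDegree + 3) := by
  apply natDegree_eq_of_degree_eq_some
  rw [CoordinateRing.degree_norm_smul_basis, degree_eq_natDegree hq]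
  by_cases hp : p = 0
  · subst hp
    simp
  · rw [degree_eq_natDegree hp]
    simp only [nsmul_eq_mul]
    rfl

lemma natDegree_norm_smul_basis_zero (p : F[X]) :
    (Algebra.norm F[X] (p • (1 : V.CoordinateRing) + (0 : F[X]) • CoordinateRing.mk V Y)).natDegree
      = 2 * p.natDegree := by
  rw [CoordinateRing.norm_smul_basis]
  simp [natDegree_pow]

/-- The norm to `F[X]` turns the pole order at infinity into the degree of a polynomial, which makes
it intrinsic to `f` and additive. -/
lemma MonicAt.natDegree_norm {f : V.CoordinateRing} {n : ℕ} (h : MonicAt f n) :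
    (Algebra.norm F[X] f).natDegree = n := by
  obtain ⟨m, p, q, rfl, ⟨rfl, hp, hpm, hq⟩ | ⟨rfl, hq, hqm, hp⟩⟩ := h
  · by_cases hq0 : q = 0
    · subst hq0
      rw [natDegree_norm_smul_basis_zero, hpm]
    · rw [natDegree_norm_smul_basis _ _ hq0]
      have := hq.resolve_left hq0
      omega
  · rw [natDegree_norm_smul_basis _ _ hq.ne_zero]
    omega

lemma isUnit_iff_algebraMap {u : V.CoordinateRing} (hu : IsUnit u) :
    ∃ c : F, c ≠ 0 ∧ u = algebraMap F V.CoordinateRing c := by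
  have h := hu.map (Algebra.norm F[X])
  obtain ⟨p, q, rfl⟩ := CoordinateRing.exists_smul_basis_eq u
  have h0 := natDegree_eq_zero_of_isUnit h
  by_cases hq : q = 0
  · subst hq
    rw [natDegree_norm_smul_basis_zero] at h0
    obtain ⟨c, rfl⟩ := natDegree_eq_zero.mp (by omega : p.natDegree = 0)
    refine ⟨c, ?_, ?_⟩
    · rintro rfl
      simp at hu
    · rw [CoordinateRing.smul]
      simp
      rfl
  · rw [natDegree_norm_smul_basis _ _ hq] at h0
    omega

lemma algebraMap_mul_smul_basis (c : F) (p q : F[X]) :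
    algebraMap F V.CoordinateRing c *
      (p • (1 : V.CoordinateRing) + q • CoordinateRing.mk V Y) =
      (C c * p) • (1 : V.CoordinateRing) + (C c * q) • CoordinateRing.mk V Y := by
  change CoordinateRing.mk V (C (C c)) * _ = _
  simp only [CoordinateRing.smul, map_mul]
  ring

lemma MonicAt.eq_of_algebraMap_mul {f g : V.CoordinateRing} {n n' : ℕ} (hf : MonicAt f n)
    (hg : MonicAt g n') {c : F} (hc : c ≠ 0) (h : f = algebraMap F V.CoordinateRing c * g) :
    c = 1 := by
  have hn : n = n' := by
    rw [← hf.natDegree_norm, ← hg.natDegree_norm, h, map_mul,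
      IsScalarTower.algebraMap_apply F F[X] V.CoordinateRing, Algebra.norm_algebraMap,
      ← C_eq_algebraMap, ← C_pow, natDegree_C_mul (pow_ne_zero _ hc)]
  obtain ⟨m, p, q, rfl, h1⟩ := hf
  obtain ⟨k, r, s, rfl, h2⟩ := hg
  rw [algebraMap_mul_smul_basis] at h
  obtain ⟨rfl, rfl⟩ := smul_basis_inj h
  rcases h1 with ⟨rfl, hp, -⟩ | ⟨rfl, hp, -⟩ <;> rcases h2 with ⟨h, hr, -⟩ | ⟨h, hr, -⟩ <;>
    first
    | omega
    | (have := hp.leadingCoeff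
       rwa [leadingCoeff_C_mul_of_isUnit (Ne.isUnit hc), hr.leadingCoeff, mul_one] at this)

/-- Units are constants, and the leading coefficient 1 leaves no choice of constant. Identities
between functions are obtained below from equalities of ideals in this way. -/
lemma MonicAt.eq_of_span_eq {f g : V.CoordinateRing} {n n' : ℕ} (hf : MonicAt f n)
    (hg : MonicAt g n') (h : Ideal.span {f} = Ideal.span {g}) : f = g := by
  obtain ⟨u, hu⟩ := Ideal.span_singleton_eq_span_singleton.mp h.symm
  obtain ⟨c, hc, hcu⟩ := isUnit_iff_algebraMap u.isUnit
  rw [hcu, mul_comm] at hu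
  rw [← hu, hf.eq_of_algebraMap_mul hg hc hu.symm, map_one, one_mul]

lemma exists_monicAt {f : V.CoordinateRing} (hf : f ≠ 0) : ∃ c : F, c ≠ 0 ∧
    MonicAt (algebraMap F V.CoordinateRing c * f) (Algebra.norm F[X] f).natDegree := by
  obtain ⟨p, q, rfl⟩ := CoordinateRing.exists_smul_basis_eq f
  have key : ∀ {r : F[X]}, r ≠ 0 → (C r.leadingCoeff⁻¹ * r).Monic ∧
      (C r.leadingCoeff⁻¹ * r).natDegree = r.natDegree := fun {r} hr =>
    ⟨by rw [mul_comm]; exact monic_mul_leadingCoeff_inv hr,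
      natDegree_C_mul (inv_ne_zero (leadingCoeff_ne_zero.mpr hr))⟩
  by_cases hq : q = 0
  · subst hq
    have hp : p ≠ 0 := by rintro rfl; simp at hf
    rw [natDegree_norm_smul_basis_zero]
    exact ⟨p.leadingCoeff⁻¹, inv_ne_zero (leadingCoeff_ne_zero.mpr hp), p.natDegree, _, _,
      algebraMap_mul_smul_basis _ _ _, Or.inl ⟨rfl, (key hp).1, (key hp).2, Or.inl (by simp)⟩⟩
  · rw [natDegree_norm_smul_basis _ _ hq]
    rcases le_or_gt (2 * p.natDegree) (2 * q.natDegree + 3) with h | h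
    · rw [max_eq_right h]
      exact ⟨q.leadingCoeff⁻¹, inv_ne_zero (leadingCoeff_ne_zero.mpr hq), q.natDegree, _, _,
        algebraMap_mul_smul_basis _ _ _, Or.inr ⟨rfl, (key hq).1, (key hq).2,
          (natDegree_C_mul_le _ _).trans (by omega)⟩⟩
    · rw [max_eq_left h.le]
      have hp : p ≠ 0 := by rintro rfl; simp at h
      exact ⟨p.leadingCoeff⁻¹, inv_ne_zero (leadingCoeff_ne_zero.mpr hp), p.natDegree, _, _,
        algebraMap_mul_smul_basis _ _ _, Or.inl ⟨rfl, (key hp).1, (key hp).2,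
          Or.inr ((Nat.add_le_add_right (natDegree_C_mul_le _ _) 2).trans (by omega))⟩⟩

end

section

variable {F : Type*} [Field F] {V : WeierstrassCurve.Affine F}

/-! ### Functions with given zeros -/

/-- `f` is the function whose zeros are the points `P i ≠ 0` for `i < n`, counted with
multiplicities, and whose leading coefficient at infinity is `1`. -/
structure IsFun (f : V.CoordinateRing) (P : ℕ → V.Point) (n : ℕ) : Prop where
  ne_zero : ∀ i < n, P i ≠ 0
  sum_eq : ∑ i ∈ Finset.range n, P i = 0
  monicAt : MonicAt f n
  span_eq : Ideal.span {f} = ∏ i ∈ Finset.range n, pointIdeal (P i)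

lemma eq_of_pointIdeal_le {P Q : V.Point} (hP : P ≠ 0) (hQ : Q ≠ 0)
    (h : pointIdeal P ≤ pointIdeal Q) : P = Q := by
  rcases P with _ | ⟨x, y, hxy⟩
  · exact absurd rfl hP
  rcases Q with _ | ⟨x', y', hxy'⟩
  · exact absurd rfl hQ
  have h1 : CoordinateRing.XClass V x ∈ pointIdeal (.some x y hxy) :=
    Ideal.subset_span (by simp)
  have h2 : CoordinateRing.YClass V (C y) ∈ pointIdeal (.some x y hxy) :=
    Ideal.subset_span (by simp)
  replace h1 := (mem_pointIdeal hQ).mp (h h1)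
  replace h2 := (mem_pointIdeal hQ).mp (h h2)
  rw [CoordinateRing.XClass, val_mk] at h1
  rw [CoordinateRing.YClass, val_mk] at h2
  simp only [evalEval_C, evalEval_sub, evalEval_X, eval_sub, eval_X, eval_C, sub_eq_zero] at h1 h2
  subst h1; subst h2; rfl

lemma val_eq_zero_iff_of_span {f : V.CoordinateRing} {P : ℕ → V.Point} {n : ℕ}
    (hP : ∀ i < n, P i ≠ 0) (h : Ideal.span {f} = ∏ i ∈ Finset.range n, pointIdeal (P i))
    {S : V.Point} (hS : S ≠ 0) : val S f = 0 ↔ ∃ i < n, P i = S := by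
  rw [← mem_pointIdeal hS, ← Ideal.span_singleton_le_iff_mem, h,
    (isMaximal_pointIdeal hS).isPrime.prod_le]
  simp only [Finset.mem_range]
  constructor
  · rintro ⟨i, hi, hle⟩
    exact ⟨i, hi, eq_of_pointIdeal_le (hP i hi) hS hle⟩
  · rintro ⟨i, hi, rfl⟩
    exact ⟨i, hi, le_rfl⟩

lemma IsFun.val_eq_zero_iff {f : V.CoordinateRing} {P : ℕ → V.Point} {n : ℕ} (hf : IsFun f P n)
    {S : V.Point} (hS : S ≠ 0) : val S f = 0 ↔ ∃ i < n, P i = S :=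
  val_eq_zero_iff_of_span hf.ne_zero hf.span_eq hS

lemma val_line_eq_zero_iff {P Q S : V.Point} (hP : P ≠ 0) (hQ : Q ≠ 0) (hPQ : P + Q ≠ 0)
    (hS : S ≠ 0) : val S (line P Q) = 0 ↔ S = P ∨ S = Q ∨ S = -(P + Q) := by
  rw [← mem_pointIdeal hS, ← Ideal.span_singleton_le_iff_mem, ← pointIdeal_mul_mul hP hQ hPQ,
    (isMaximal_pointIdeal hS).isPrime.mul_le, (isMaximal_pointIdeal hS).isPrime.mul_le, or_assoc]
  refine or_congr ?_ (or_congr ?_ ?_)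
  · exact ⟨fun h => (eq_of_pointIdeal_le hP hS h).symm, fun h => h ▸ le_rfl⟩
  · exact ⟨fun h => (eq_of_pointIdeal_le hQ hS h).symm, fun h => h ▸ le_rfl⟩
  · exact ⟨fun h => (eq_of_pointIdeal_le (neg_ne_zero.mpr hPQ) hS h).symm, fun h => h ▸ le_rfl⟩

lemma val_vert_eq_zero_iff {P S : V.Point} (hP : P ≠ 0) (hS : S ≠ 0) :
    val S (vert P) = 0 ↔ S = P ∨ S = -P := by
  rw [← mem_pointIdeal hS, ← Ideal.span_singleton_le_iff_mem, ← pointIdeal_neg_mul hP,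
    (isMaximal_pointIdeal hS).isPrime.mul_le, or_comm]
  refine or_congr ?_ ?_
  · exact ⟨fun h => (eq_of_pointIdeal_le hP hS h).symm, fun h => h ▸ le_rfl⟩
  · exact ⟨fun h => (eq_of_pointIdeal_le (neg_ne_zero.mpr hP) hS h).symm, fun h => h ▸ le_rfl⟩

/-- The partial sums `S + P 0 + ⋯ + P (i - 1)`. -/
def walk (S : V.Point) (P : ℕ → V.Point) (i : ℕ) : V.Point := S + ∑ j ∈ Finset.range i, P j

lemma walk_succ (S : V.Point) (P : ℕ → V.Point) (i : ℕ) :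
    walk S P (i + 1) = P i + walk S P i := by
  rw [walk, walk, Finset.sum_range_succ]; abel

lemma prod_walk {M : Type*} [CommMonoid M] {P : ℕ → V.Point} {n : ℕ}
    (h : ∑ i ∈ Finset.range n, P i = 0) (S : V.Point) (φ : V.Point → M) :
    ∏ i ∈ Finset.range n, φ (walk S P (i + 1)) = ∏ i ∈ Finset.range n, φ (walk S P i) := by
  cases n with
  | zero => rfl
  | succ n =>
    rw [Finset.prod_range_succ, Finset.prod_range_succ' (fun i => φ (walk S P i))]
    congr 2
    rw [walk, h, walk, Finset.sum_range_zero]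

/-- Each index rules out finitely many starting points. The freedom keeps the denominators in the
reciprocity arguments nonzero. -/
lemma exists_walk [Infinite V.Point] (P : ℕ → V.Point) (n : ℕ) (B : Finset V.Point) :
    ∃ S : V.Point, ∀ i ≤ n, walk S P i ∉ B := by
  obtain ⟨S, hS⟩ := Infinite.exists_notMem_finset
    ((Finset.range (n + 1)).biUnion fun i => B.image (· - ∑ j ∈ Finset.range i, P j))
  refine ⟨S, fun i hi h => hS ?_⟩
  rw [Finset.mem_biUnion]
  exact ⟨i, Finset.mem_range.mpr (by omega), Finset.mem_image.mpr ⟨_, h, by rw [walk]; abel⟩⟩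

/-- Writing S_i for the walk, the i-th line has zeros P_i, S_i, -S_{i+1} and the i-th vertical has
zeros S_{i+1}, -S_{i+1}. As the walk is closed, the S_i and the S_{i+1} have the same product of
ideals and cancel, leaving the P_i. -/
lemma span_mul_prod_vert {f : V.CoordinateRing} {P : ℕ → V.Point} {n : ℕ}
    (hP : ∀ i < n, P i ≠ 0) (hsum : ∑ i ∈ Finset.range n, P i = 0)
    (hf : Ideal.span {f} = ∏ i ∈ Finset.range n, pointIdeal (P i))
    {S : V.Point} (hS : ∀ i ≤ n, walk S P i ≠ 0) :
    Ideal.span {f * ∏ i ∈ Finset.range n, vert (walk S P (i + 1))} =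
      Ideal.span {∏ i ∈ Finset.range n, line (P i) (walk S P i)} := by
  rw [← Ideal.span_singleton_mul_span_singleton, hf, ← Ideal.prod_span_singleton,
    ← Ideal.prod_span_singleton]
  have h1 : ∏ i ∈ Finset.range n, Ideal.span {line (P i) (walk S P i)} =
      ∏ i ∈ Finset.range n, (pointIdeal (P i) * pointIdeal (walk S P i) *
        pointIdeal (-walk S P (i + 1))) := by
    refine Finset.prod_congr rfl fun i hi => ?_
    have hi := Finset.mem_range.mp hi
    rw [walk_succ, pointIdeal_mul_mul (hP i hi) (hS i hi.le)
      (by rw [← walk_succ]; exact hS _ hi)]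
  have h2 : ∏ i ∈ Finset.range n, Ideal.span {vert (walk S P (i + 1))} =
      ∏ i ∈ Finset.range n, (pointIdeal (-walk S P (i + 1)) * pointIdeal (walk S P (i + 1))) :=
    Finset.prod_congr rfl fun i hi => (pointIdeal_neg_mul (hS _ (Finset.mem_range.mp hi))).symm
  rw [h1, h2, Finset.prod_mul_distrib, Finset.prod_mul_distrib, Finset.prod_mul_distrib,
    prod_walk hsum S pointIdeal, mul_assoc, mul_comm (∏ i ∈ Finset.range n, pointIdeal (-_))]

/-- A function is a quotient of products of lines. -/
lemma IsFun.mul_prod_vert {f : V.CoordinateRing} {P : ℕ → V.Point} {n : ℕ} (hf : IsFun f P n)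
    {S : V.Point} (hS : ∀ i ≤ n, walk S P i ≠ 0) :
    f * ∏ i ∈ Finset.range n, vert (walk S P (i + 1)) =
      ∏ i ∈ Finset.range n, line (P i) (walk S P i) :=
  (hf.monicAt.mul (MonicAt.prod n fun _ _ => monicAt_vert _)).eq_of_span_eq
    (MonicAt.prod n fun _ _ => monicAt_line _ _)
    (span_mul_prod_vert hf.ne_zero hf.sum_eq hf.span_eq hS)

lemma IsFun.val_mul_prod_vert {f : V.CoordinateRing} {P : ℕ → V.Point} {n : ℕ} (hf : IsFun f P n)
    {S : V.Point} (hS : ∀ i ≤ n, walk S P i ≠ 0) (R : V.Point) :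
    val R f * ∏ i ∈ Finset.range n, val R (vert (walk S P (i + 1))) =
      ∏ i ∈ Finset.range n, val R (line (P i) (walk S P i)) := by
  rw [← map_prod, ← map_prod, ← map_mul, hf.mul_prod_vert hS]

/-! ### Reciprocity -/

/-- Expand `g` into lines and verticals along a closed walk and apply the two elementary laws to
each factor. The values of the fixed line at the points of the walk and at their negatives cancel,
and each line of the expansion contributes one sign. -/
lemma IsFun.line_reciprocity [Infinite V.Point] {g : V.CoordinateRing} {R : ℕ → V.Point} {m : ℕ}
    (hg : IsFun g R m) {P Q : V.Point} (hP : P ≠ 0) (hQ : Q ≠ 0) (hPQ : P + Q ≠ 0) :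
    val P g * val Q g * val (-(P + Q)) g =
      (-1) ^ m * ∏ j ∈ Finset.range m, val (R j) (line P Q) := by
  -- Besides infinity, the walk avoids the zeros of the fixed line and their negatives, so the
  -- factor `hne` to be cancelled is nonzero.
  obtain ⟨S, hS⟩ := exists_walk R m {0, P, Q, -(P + Q), -P, -Q, P + Q}
  simp only [Finset.mem_insert, Finset.mem_singleton, not_or] at hS
  have hS0 : ∀ i ≤ m, walk S R i ≠ 0 := fun i hi => (hS i hi).1
  have e := hg.val_mul_prod_vert hS0
  have key : ∏ j ∈ Finset.range m, (val P (line (R j) (walk S R j)) *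
      val Q (line (R j) (walk S R j)) * val (-(P + Q)) (line (R j) (walk S R j))) =
      ∏ j ∈ Finset.range m, (-1 * (val (R j) (line P Q) * val (walk S R j) (line P Q) *
        val (-walk S R (j + 1)) (line P Q))) := by
    refine Finset.prod_congr rfl fun j hj => ?_
    have hj := Finset.mem_range.mp hj
    rw [walk_succ, line_line_reciprocity hP hQ hPQ (hg.ne_zero j hj) (hS0 j hj.le)
      (by rw [← walk_succ]; exact hS0 _ hj)]
    ring
  have key' : ∏ j ∈ Finset.range m, (val P (vert (walk S R (j + 1))) *
      val Q (vert (walk S R (j + 1))) * val (-(P + Q)) (vert (walk S R (j + 1)))) =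
      ∏ j ∈ Finset.range m, (val (walk S R (j + 1)) (line P Q) *
        val (-walk S R (j + 1)) (line P Q)) :=
    Finset.prod_congr rfl fun j hj =>
      (line_vert_reciprocity hP hQ hPQ (hS0 _ (Finset.mem_range.mp hj))).symm
  have hne : ∏ j ∈ Finset.range m, (val (walk S R (j + 1)) (line P Q) *
        val (-walk S R (j + 1)) (line P Q)) ≠ 0 := by
    refine Finset.prod_ne_zero_iff.mpr fun j hj => mul_ne_zero ?_ ?_
    · have h := hS (j + 1) (Finset.mem_range.mp hj)
      rw [Ne, val_line_eq_zero_iff hP hQ hPQ h.1]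
      tauto
    · have h := hS (j + 1) (Finset.mem_range.mp hj)
      rw [Ne, val_line_eq_zero_iff hP hQ hPQ (neg_ne_zero.mpr h.1), neg_eq_iff_eq_neg,
        neg_eq_iff_eq_neg, neg_inj]
      tauto
  apply mul_right_cancel₀ hne
  simp only [Finset.prod_mul_distrib, Finset.prod_const, Finset.card_range,
    prod_walk hg.sum_eq S (fun T => val T (line P Q))] at key key' ⊢
  rw [← key']
  linear_combination (val Q g * val (-(P + Q)) g *
    (∏ i ∈ Finset.range m, val Q (vert (walk S R (i + 1)))) *
    (∏ i ∈ Finset.range m, val (-(P + Q)) (vert (walk S R (i + 1))))) * e P +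
    ((∏ i ∈ Finset.range m, val P (line (R i) (walk S R i))) * val (-(P + Q)) g *
    (∏ i ∈ Finset.range m, val (-(P + Q)) (vert (walk S R (i + 1))))) * e Q +
    ((∏ i ∈ Finset.range m, val P (line (R i) (walk S R i))) *
    (∏ i ∈ Finset.range m, val Q (line (R i) (walk S R i)))) * e (-(P + Q)) + key -
    (-1) ^ m * (∏ j ∈ Finset.range m, val (R j) (line P Q)) * key'

lemma IsFun.vert_reciprocity [Infinite V.Point] {g : V.CoordinateRing} {R : ℕ → V.Point} {m : ℕ}
    (hg : IsFun g R m) {P : V.Point} (hP : P ≠ 0) :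
    val P g * val (-P) g = ∏ j ∈ Finset.range m, val (R j) (vert P) := by
  obtain ⟨S, hS⟩ := exists_walk R m {0, P, -P}
  simp only [Finset.mem_insert, Finset.mem_singleton, not_or] at hS
  have hS0 : ∀ i ≤ m, walk S R i ≠ 0 := fun i hi => (hS i hi).1
  have e := hg.val_mul_prod_vert hS0
  have key : ∏ j ∈ Finset.range m, (val P (line (R j) (walk S R j)) *
      val (-P) (line (R j) (walk S R j))) =
      ∏ j ∈ Finset.range m, (val (R j) (vert P) * val (walk S R j) (vert P) *
        val (-walk S R (j + 1)) (vert P)) := by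
    refine Finset.prod_congr rfl fun j hj => ?_
    have hj := Finset.mem_range.mp hj
    rw [walk_succ, line_vert_reciprocity (hg.ne_zero j hj) (hS0 j hj.le)
      (by rw [← walk_succ]; exact hS0 _ hj) hP]
  have hx : ∀ T : V.Point, xCoord (-T) = xCoord T := by rintro (_ | _) <;> rfl
  have key' : ∏ j ∈ Finset.range m, (val P (vert (walk S R (j + 1))) *
      val (-P) (vert (walk S R (j + 1)))) =
      ∏ j ∈ Finset.range m, (val (walk S R (j + 1)) (vert P) *
        val (-walk S R (j + 1)) (vert P)) := by
    refine Finset.prod_congr rfl fun j hj => ?_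
    have h := hS0 _ (Finset.mem_range.mp hj)
    rw [val_vert _ hP, val_vert _ (neg_ne_zero.mpr hP), val_vert _ h,
      val_vert _ (neg_ne_zero.mpr h), hx, hx]
    ring
  have hne : ∏ j ∈ Finset.range m, (val (walk S R (j + 1)) (vert P) *
        val (-walk S R (j + 1)) (vert P)) ≠ 0 := by
    refine Finset.prod_ne_zero_iff.mpr fun j hj => mul_ne_zero ?_ ?_
    · have h := hS (j + 1) (Finset.mem_range.mp hj)
      rw [Ne, val_vert_eq_zero_iff hP h.1]
      tauto
    · have h := hS (j + 1) (Finset.mem_range.mp hj)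
      rw [Ne, val_vert_eq_zero_iff hP (neg_ne_zero.mpr h.1), neg_eq_iff_eq_neg, neg_inj]
      tauto
  apply mul_right_cancel₀ hne
  simp only [Finset.prod_mul_distrib, prod_walk hg.sum_eq S (fun T => val T (vert P))]
    at key key' ⊢
  rw [← key']
  linear_combination (val (-P) g *
    (∏ i ∈ Finset.range m, val (-P) (vert (walk S R (i + 1))))) * e P +
    (∏ i ∈ Finset.range m, val P (line (R i) (walk S R i))) * e (-P) + key -
    (∏ j ∈ Finset.range m, val (R j) (vert P)) * key'

/-- Weil reciprocity for two functions without zeros and poles at infinity. -/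
theorem IsFun.reciprocity [Infinite V.Point] {f g : V.CoordinateRing} {P R : ℕ → V.Point}
    {n m : ℕ} (hf : IsFun f P n) (hg : IsFun g R m) :
    ∏ j ∈ Finset.range m, val (R j) f =
      (-1) ^ (n * m) * ∏ i ∈ Finset.range n, val (P i) g := by
  -- Now `f` is expanded; the walk avoids the zeros of `g` and their negatives, so that the values
  -- of `g` along it can be cancelled.
  obtain ⟨S, hS⟩ := exists_walk P n
    ({0} ∪ ((Finset.range m).image R ∪ (Finset.range m).image (fun j => -R j)))
  simp only [Finset.mem_union, Finset.mem_singleton, Finset.mem_image, not_or, not_exists,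
    not_and, Finset.mem_range] at hS
  have hS0 : ∀ i ≤ n, walk S P i ≠ 0 := fun i hi => (hS i hi).1
  have e : ∏ j ∈ Finset.range m, (val (R j) f *
      ∏ i ∈ Finset.range n, val (R j) (vert (walk S P (i + 1)))) =
      ∏ j ∈ Finset.range m, ∏ i ∈ Finset.range n, val (R j) (line (P i) (walk S P i)) :=
    Finset.prod_congr rfl fun j _ => hf.val_mul_prod_vert hS0 (R j)
  rw [Finset.prod_mul_distrib, Finset.prod_comm, Finset.prod_comm (s := Finset.range m)] at e
  have h1 : ∏ i ∈ Finset.range n, ∏ j ∈ Finset.range m, val (R j) (vert (walk S P (i + 1))) =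
      ∏ i ∈ Finset.range n, (val (walk S P (i + 1)) g * val (-walk S P (i + 1)) g) :=
    Finset.prod_congr rfl fun i hi =>
      (hg.vert_reciprocity (hS0 _ (Finset.mem_range.mp hi))).symm
  have h2 : ∏ i ∈ Finset.range n, ∏ j ∈ Finset.range m, val (R j) (line (P i) (walk S P i)) =
      ∏ i ∈ Finset.range n, ((-1) ^ m * (val (P i) g * val (walk S P i) g *
        val (-walk S P (i + 1)) g)) := by
    refine Finset.prod_congr rfl fun i hi => ?_
    have hi := Finset.mem_range.mp hi
    rw [walk_succ, hg.line_reciprocity (hf.ne_zero i hi) (hS0 i hi.le)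
      (by rw [← walk_succ]; exact hS0 _ hi), ← mul_assoc, ← pow_add, Even.neg_one_pow (by simp),
      one_mul]
  rw [h1, h2] at e
  have hne : ∏ i ∈ Finset.range n, (val (walk S P (i + 1)) g * val (-walk S P (i + 1)) g) ≠ 0 := by
    refine Finset.prod_ne_zero_iff.mpr fun i hi => mul_ne_zero ?_ ?_
    · have h := hS (i + 1) (Finset.mem_range.mp hi)
      rw [Ne, hg.val_eq_zero_iff h.1]
      rintro ⟨j, hj, hj'⟩
      exact h.2.1 j hj hj'
    · have h := hS (i + 1) (Finset.mem_range.mp hi)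
      rw [Ne, hg.val_eq_zero_iff (neg_ne_zero.mpr h.1)]
      rintro ⟨j, hj, hj'⟩
      exact h.2.2 j hj (by rw [hj', neg_neg])
  apply mul_right_cancel₀ hne
  rw [e]
  simp only [Finset.prod_mul_distrib, prod_walk hf.sum_eq S (fun T => val T g),
    Finset.prod_const, Finset.card_range]
  rw [mul_comm n, pow_mul]
  ring

end

section

/-! ### Change of fields -/

section Map

variable {F K L : Type*} [Field F] [Field K] [Field L] {V : WeierstrassCurve.Affine F}
  {V' : WeierstrassCurve.Affine K} {V'' : WeierstrassCurve.Affine L}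

/-- The map of coordinate rings induced by a homomorphism of fields. -/
def mapFun (f : F →+* K) (h : V.map f = V') : V.CoordinateRing →+* V'.CoordinateRing :=
  h ▸ CoordinateRing.map V f

/-- The map of points induced by a homomorphism of fields. -/
def mapPoint (f : F →+* K) (h : V.map f = V') : V.Point →+ V'.Point where
  toFun
    | .zero => .zero
    | .some x y hxy => .some (f x) (f y) (by
        subst h; exact (map_nonsingular _ f.injective ..).mpr hxy)
  map_zero' := rfl
  map_add' := by
    subst h
    rintro (_ | ⟨x₁, y₁, h₁⟩) (_ | ⟨x₂, y₂, h₂⟩)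
    any_goals rfl
    by_cases hxy : x₁ = x₂ ∧ y₁ = V.negY x₂ y₂
    · rw [Point.add_of_Y_eq hxy.left hxy.right]
      exact (Point.add_of_Y_eq (congr_arg _ hxy.left) (by rw [hxy.right, map_negY])).symm
    · rw [Point.add_some hxy]
      simp only [← map_addX, ← map_addY, ← map_slope]
      exact (Point.add_some fun h ↦ hxy ⟨f.injective h.1,
        f.injective ((map_negY (W' := V) f ..) ▸ h.2)⟩).symm

lemma mapPoint_injective (f : F →+* K) (h : V.map f = V') :
    Function.Injective (mapPoint f h) := by
  rintro (_ | ⟨x₁, y₁, h₁⟩) (_ | ⟨x₂, y₂, h₂⟩) e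
  · rfl
  · exact absurd e (by simp [mapPoint])
  · exact absurd e (by simp [mapPoint])
  · simp only [mapPoint, AddMonoidHom.coe_mk, ZeroHom.coe_mk, Point.some.injEq] at e
    simpa using ⟨f.injective e.1, f.injective e.2⟩

lemma mapPoint_ne_zero (f : F →+* K) (h : V.map f = V') {P : V.Point} (hP : P ≠ 0) :
    mapPoint f h P ≠ 0 :=
  (map_ne_zero_iff _ (mapPoint_injective f h)).mpr hP

/-- Target curves are tied to base changes by equations, so that an automorphism of the big field
acts on the points of one and the same curve and visibly fixes those coming from below. -/
lemma mapPoint_mapPoint (f : F →+* K) (g : K →+* L) (e : F →+* L) (hfg : g.comp f = e)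
    (h : V.map f = V') (h' : V'.map g = V'') (h'' : V.map e = V'') (P : V.Point) :
    mapPoint g h' (mapPoint f h P) = mapPoint e h'' P := by
  subst hfg
  rcases P with _ | _ <;> rfl

lemma xCoord_mapPoint (f : F →+* K) (h : V.map f = V') (P : V.Point) :
    xCoord (mapPoint f h P) = f (xCoord P) := by
  rcases P with _ | _
  · exact (map_zero f).symm
  · rfl

lemma yCoord_mapPoint (f : F →+* K) (h : V.map f = V') (P : V.Point) :
    yCoord (mapPoint f h P) = f (yCoord P) := by
  rcases P with _ | _
  · exact (map_zero f).symm
  · rfl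

lemma mapFun_mk (f : F →+* K) (h : V.map f = V') (p : F[X][Y]) :
    mapFun f h (CoordinateRing.mk V p) = CoordinateRing.mk V' (p.map (mapRingHom f)) := by
  subst h
  exact CoordinateRing.map_mk f p

lemma mapFun_smul_basis (f : F →+* K) (h : V.map f = V') (p q : F[X]) :
    mapFun f h (p • 1 + q • CoordinateRing.mk V Y) =
      p.map f • (1 : V'.CoordinateRing) + q.map f • CoordinateRing.mk V' Y := by
  simp only [CoordinateRing.smul, map_add, map_mul, map_one, mapFun_mk, map_C, map_X,
    coe_mapRingHom]

lemma mapFun_mapFun (f : F →+* K) (g : K →+* L) (e : F →+* L) (hfg : g.comp f = e)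
    (h : V.map f = V') (h' : V'.map g = V'') (h'' : V.map e = V'') (x : V.CoordinateRing) :
    mapFun g h' (mapFun f h x) = mapFun e h'' x := by
  subst hfg
  obtain ⟨p, q, rfl⟩ := CoordinateRing.exists_smul_basis_eq x
  simp only [mapFun_smul_basis, Polynomial.map_map]

lemma val_mapFun (f : F →+* K) (h : V.map f = V') (P : V.Point) (x : V.CoordinateRing) :
    val (mapPoint f h P) (mapFun f h x) = f (val P x) := by
  by_cases hP : P = 0
  · subst hP
    rw [_root_.map_zero]
    exact (map_one f).symm
  obtain ⟨p, q, rfl⟩ := CoordinateRing.exists_smul_basis_eq x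
  rw [mapFun_smul_basis, val_smul_basis (mapPoint_ne_zero f h hP), val_smul_basis hP,
    xCoord_mapPoint, yCoord_mapPoint, eval_map_apply, eval_map_apply, map_add, map_mul]

lemma MonicAt.map (f : F →+* K) (h : V.map f = V') {x : V.CoordinateRing} {n : ℕ}
    (hx : MonicAt x n) : MonicAt (mapFun f h x) n := by
  obtain ⟨m, p, q, rfl, hpq⟩ := hx
  refine ⟨m, p.map f, q.map f, mapFun_smul_basis f h p q, ?_⟩
  rcases hpq with ⟨hn, hp, hpm, hq⟩ | ⟨hn, hq, hqm, hp⟩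
  · refine Or.inl ⟨hn, hp.map f, by rw [natDegree_map, hpm], ?_⟩
    rcases hq with rfl | hq
    · simp
    · right; rwa [natDegree_map]
  · exact Or.inr ⟨hn, hq.map f, by rw [natDegree_map, hqm], by rwa [natDegree_map]⟩

lemma map_pointIdeal (f : F →+* K) (h : V.map f = V') (P : V.Point) :
    (pointIdeal P).map (mapFun f h) = pointIdeal (mapPoint f h P) := by
  rcases P with _ | ⟨x, y, hxy⟩
  · exact Ideal.map_top _
  · change Ideal.map _ (Ideal.span _) = Ideal.span _
    rw [Ideal.map_span, Set.image_pair]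
    simp only [CoordinateRing.XClass, CoordinateRing.YClass, mapFun_mk, Polynomial.map_sub, map_C,
      map_X, coe_mapRingHom]

lemma span_mapFun (f : F →+* K) (h : V.map f = V') {x : V.CoordinateRing} {P : ℕ → V.Point}
    {n : ℕ} (hx : Ideal.span {x} = ∏ i ∈ Finset.range n, pointIdeal (P i)) :
    Ideal.span {mapFun f h x} = ∏ i ∈ Finset.range n, pointIdeal (mapPoint f h (P i)) := by
  have := congr_arg (Ideal.map (mapFun f h)) hx
  rw [Ideal.map_span, Set.image_singleton, ← Ideal.mapHom_apply, map_prod] at this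
  simpa only [Ideal.mapHom_apply, map_pointIdeal] using this

lemma IsFun.map (f : F →+* K) (h : V.map f = V') {x : V.CoordinateRing} {P : ℕ → V.Point} {n : ℕ}
    (hx : IsFun x P n) : IsFun (mapFun f h x) (fun i => mapPoint f h (P i)) n where
  ne_zero i hi := mapPoint_ne_zero f h (hx.ne_zero i hi)
  sum_eq := by rw [← map_sum, hx.sum_eq, _root_.map_zero]
  monicAt := hx.monicAt.map f h
  span_eq := span_mapFun f h hx.span_eq

end Map

/-! ### Existence of functions -/

variable {F : Type*} [Field F] {V : WeierstrassCurve.Affine F}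

lemma exists_point [V.IsElliptic] [IsAlgClosed F] (x : F) :
    ∃ P : V.Point, P ≠ 0 ∧ xCoord P = x := by
  obtain ⟨y, hy⟩ := IsAlgClosed.exists_root (X ^ 2 + C (V.a₁ * x + V.a₃) * X -
    C (x ^ 3 + V.a₂ * x ^ 2 + V.a₄ * x + V.a₆)) (by
      have : (X ^ 2 + C (V.a₁ * x + V.a₃) * X -
        C (x ^ 3 + V.a₂ * x ^ 2 + V.a₄ * x + V.a₆)).natDegree = 2 := by compute_degree!
      exact fun h => by rw [natDegree_eq_zero_iff_degree_le_zero.mpr h.le] at this; omega)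
  have h : V.Equation x y := by
    rw [equation_iff']
    simp only [IsRoot, eval_sub, eval_add, eval_mul, eval_pow, eval_X, eval_C] at hy
    linear_combination hy
  exact ⟨.mk h, Point.some_ne_zero _, rfl⟩

instance [V.IsElliptic] [IsAlgClosed F] : Infinite V.Point :=
  Infinite.of_surjective xCoord fun x => (exists_point x).imp fun _ h => h.2

/-- The invertible ideal of a point. -/
def pointUnit : V.Point → (FractionalIdeal (nonZeroDivisors V.CoordinateRing) V.FunctionField)ˣ
  | .zero => 1
  | .some _ _ h => CoordinateRing.XYIdeal' (W := V) h

lemma coe_pointUnit (P : V.Point) :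
    (pointUnit P : FractionalIdeal (nonZeroDivisors V.CoordinateRing) V.FunctionField) =
      (pointIdeal P : Ideal V.CoordinateRing) := by
  rcases P with _ | ⟨x, y, h⟩
  · exact (FractionalIdeal.coeIdeal_top _).symm
  · rfl

lemma toClass_eq (P : V.Point) :
    Point.toClass P = Additive.ofMul (ClassGroup.mk V.FunctionField (pointUnit P)) := by
  rcases P with _ | ⟨x, y, h⟩
  · simp only [pointUnit, map_one]; rfl
  · rfl

/-- The map from points to the ideal class group is a homomorphism, so a vanishing sum of points
makes the product of their ideals principal. -/
lemma prod_pointIdeal_principal {P : ℕ → V.Point} {n : ℕ}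
    (hsum : ∑ i ∈ Finset.range n, P i = 0) :
    ∃ f : V.CoordinateRing, f ≠ 0 ∧
      Ideal.span {f} = ∏ i ∈ Finset.range n, pointIdeal (P i) := by
  have h1 : ClassGroup.mk V.FunctionField (∏ i ∈ Finset.range n, pointUnit (P i)) = 1 := by
    rw [map_prod]
    have := congr_arg Point.toClass hsum
    simpa only [map_sum, toClass_eq, ← ofMul_prod, pointUnit, Point.zero_def, map_one,
      Additive.ofMul.injective.eq_iff] using this
  obtain ⟨f, hf, h⟩ := (ClassGroup.mk_eq_one_of_coe_ideal
    (I' := ∏ i ∈ Finset.range n, pointIdeal (P i)) (by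
      rw [Units.coe_prod, Finset.prod_congr rfl fun i _ => coe_pointUnit (P i)]
      induction Finset.range n using Finset.induction_on with
      | empty => simp
      | insert a s ha ih => rw [Finset.prod_insert ha, Finset.prod_insert ha, ih,
          FractionalIdeal.coeIdeal_mul])).mp h1
  exact ⟨f, hf, h.symm⟩

/-- Counting pole orders in the expansion into lines and verticals gives `N + 2 * n = 3 * n`. -/
lemma natDegree_eq_of_span [Infinite V.Point] {f : V.CoordinateRing} {P : ℕ → V.Point} {n N : ℕ}
    (hP : ∀ i < n, P i ≠ 0) (hsum : ∑ i ∈ Finset.range n, P i = 0)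
    (hf : Ideal.span {f} = ∏ i ∈ Finset.range n, pointIdeal (P i)) (hN : MonicAt f N) : N = n := by
  obtain ⟨S, hS⟩ := exists_walk P n {0}
  have h1 := hN.mul (MonicAt.prod n fun i _ => monicAt_vert (walk S P (i + 1)))
  have h2 := MonicAt.prod n fun i _ => monicAt_line (P i) (walk S P i)
  have h := h1.eq_of_span_eq h2 (span_mul_prod_vert hP hsum hf fun i hi => by simpa using hS i hi)
  have := h1.natDegree_norm
  rw [h, h2.natDegree_norm] at this
  omega

theorem exists_isFun [V.IsElliptic] {P : ℕ → V.Point} {n : ℕ} (hP : ∀ i < n, P i ≠ 0)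
    (hsum : ∑ i ∈ Finset.range n, P i = 0) : ∃ f : V.CoordinateRing, IsFun f P n := by
  obtain ⟨f, hf0, hf⟩ := prod_pointIdeal_principal hsum
  obtain ⟨c, hc, hm⟩ := exists_monicAt hf0
  have hspan : Ideal.span {algebraMap F V.CoordinateRing c * f} =
      ∏ i ∈ Finset.range n, pointIdeal (P i) := by
    rw [← hf, Ideal.span_singleton_mul_left_unit ((Ne.isUnit hc).map _)]
  -- Walks need infinitely many points, so the pole order is computed over the algebraic closure;
  -- base change does not alter it.
  have hN := natDegree_eq_of_span (V := (V.map (algebraMap F (AlgebraicClosure F))).toAffine)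
    (fun i hi => mapPoint_ne_zero _ rfl (hP i hi))
    (by rw [← map_sum, hsum, _root_.map_zero]) (span_mapFun _ rfl hspan) (hm.map _ rfl)
  exact ⟨_, hP, hsum, hN ▸ hm, hspan⟩

end

section

/-! ### The Kummer function -/

section Kummer

variable {F K : Type*} [Field F] [Field K] {V : WeierstrassCurve.Affine F}
  {V' : WeierstrassCurve.Affine K} {ℓ : ℕ}

lemma IsFun.unique {f g : V.CoordinateRing} {P : ℕ → V.Point} {n : ℕ} (hf : IsFun f P n)
    (hg : IsFun g P n) : f = g :=
  hf.monicAt.eq_of_span_eq hg.monicAt (hf.span_eq.trans hg.span_eq.symm)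

/-- The points `P, …, P, -(ℓ • P)`. -/
def divSeq (ℓ : ℕ) (P : V.Point) (i : ℕ) : V.Point := if i < ℓ then P else -(ℓ • P)

lemma prod_divSeq {M : Type*} [CommMonoid M] (φ : V.Point → M) (P : V.Point) :
    ∏ i ∈ Finset.range (ℓ + 1), φ (divSeq ℓ P i) = φ P ^ ℓ * φ (-(ℓ • P)) := by
  have h : ∀ i ∈ Finset.range ℓ, φ (divSeq ℓ P i) = φ P := fun i hi => by
    rw [divSeq, if_pos (Finset.mem_range.mp hi)]
  rw [Finset.prod_range_succ, Finset.prod_congr rfl h, divSeq, if_neg (lt_irrefl _)]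
  simp

lemma sum_divSeq (P : V.Point) : ∑ i ∈ Finset.range (ℓ + 1), divSeq ℓ P i = 0 := by
  have h : ∀ i ∈ Finset.range ℓ, divSeq ℓ P i = P := fun i hi => by
    rw [divSeq, if_pos (Finset.mem_range.mp hi)]
  rw [Finset.sum_range_succ, Finset.sum_congr rfl h, divSeq, if_neg (lt_irrefl _)]
  simp

variable (ℓ) in
/-- The function with zeros `ℓ (P) + (-ℓ P)`. -/
def divFun (P : V.Point) : V.CoordinateRing :=
  if h : ∃ f, IsFun f (divSeq ℓ P) (ℓ + 1) then h.choose else 0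

variable (ℓ) in
/-- The function with zeros `ℓ (T)`, for an `ℓ`-torsion point `T`. -/
def torsFun (T : V.Point) : V.CoordinateRing :=
  if h : ∃ f, IsFun f (fun _ => T) ℓ then h.choose else 0

lemma isFun_divFun [V.IsElliptic] {P : V.Point} (hP : ℓ • P ≠ 0) :
    IsFun (divFun ℓ P) (divSeq ℓ P) (ℓ + 1) := by
  have h : ∃ f, IsFun f (divSeq ℓ P) (ℓ + 1) := by
    refine exists_isFun (fun i _ => ?_) (sum_divSeq P)
    rw [divSeq]
    split_ifs
    · rintro rfl; exact hP (smul_zero _)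
    · exact neg_ne_zero.mpr hP
  rw [divFun, dif_pos h]
  exact h.choose_spec

lemma isFun_torsFun [V.IsElliptic] {T : V.Point} (hT : T ≠ 0) (hT' : ℓ • T = 0) :
    IsFun (torsFun ℓ T) (fun _ => T) ℓ := by
  have h : ∃ f, IsFun f (fun _ => T) ℓ := exists_isFun (fun _ _ => hT) (by simpa using hT')
  rw [torsFun, dif_pos h]
  exact h.choose_spec

lemma IsFun.eq_torsFun [V.IsElliptic] {h : V.CoordinateRing} {T : V.Point} (hT : T ≠ 0)
    (hT' : ℓ • T = 0) (hh : IsFun h (fun _ => T) ℓ) : h = torsFun ℓ T :=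
  hh.unique (isFun_torsFun hT hT')

variable (ℓ) in
/-- An `ℓ`-th root of the value of `torsFun ℓ W` at `-ℓ P`. -/
def kummer (W P : V.Point) : F := val W (divFun ℓ P) / val P (torsFun ℓ W)

lemma val_torsFun_ne_zero [V.IsElliptic] {T P : V.Point} (hT : T ≠ 0) (hT' : ℓ • T = 0)
    (hP : P ≠ T) : val P (torsFun ℓ T) ≠ 0 := by
  by_cases h0 : P = 0
  · subst h0; exact one_ne_zero
  · rw [Ne, (isFun_torsFun hT hT').val_eq_zero_iff h0]
    rintro ⟨_, _, rfl⟩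
    exact hP rfl

/-- This is reciprocity between `divFun ℓ P` and `torsFun ℓ W`. The sign has exponent `(ℓ + 1) * ℓ`,
which is even. -/
lemma kummer_pow_of_infinite [V.IsElliptic] [Infinite V.Point] {W P : V.Point} (hW : W ≠ 0)
    (hW' : ℓ • W = 0) (hP : ℓ • P ≠ 0) :
    kummer ℓ W P ^ ℓ = val (-(ℓ • P)) (torsFun ℓ W) := by
  have hPW : P ≠ W := by rintro rfl; exact hP hW'
  have h := (isFun_divFun hP).reciprocity (isFun_torsFun hW hW')
  rw [Even.neg_one_pow (by rw [mul_comm]; exact Nat.even_mul_succ_self ℓ), one_mul,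
    prod_divSeq (fun R => val R (torsFun ℓ W)), Finset.prod_const, Finset.card_range] at h
  rw [kummer, div_pow, h, mul_div_cancel_left₀]
  exact pow_ne_zero _ (val_torsFun_ne_zero hW hW' hPW)

lemma mapFun_divFun [V.IsElliptic] [V'.IsElliptic] (f : F →+* K) (h : V.map f = V') {P : V.Point}
    (hP : ℓ • P ≠ 0) : mapFun f h (divFun ℓ P) = divFun ℓ (mapPoint f h P) := by
  have h1 := (isFun_divFun hP).map f h
  have h2 : (fun i => mapPoint f h (divSeq ℓ P i)) = divSeq ℓ (mapPoint f h P) := by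
    ext1 i
    simp only [divSeq]
    split_ifs
    · rfl
    · rw [map_neg, map_nsmul]
  rw [h2] at h1
  exact h1.unique (isFun_divFun (by rw [← map_nsmul]; exact mapPoint_ne_zero f h hP))

lemma mapFun_torsFun [V.IsElliptic] [V'.IsElliptic] (f : F →+* K) (h : V.map f = V') {T : V.Point}
    (hT : T ≠ 0) (hT' : ℓ • T = 0) :
    mapFun f h (torsFun ℓ T) = torsFun ℓ (mapPoint f h T) :=
  ((isFun_torsFun hT hT').map f h).unique (isFun_torsFun (mapPoint_ne_zero f h hT)
    (by rw [← map_nsmul, hT', map_zero]))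

/-- Both functions are determined by their zeros and leading coefficients, hence commute with field
homomorphisms. For an automorphism this is the Galois equivariance of κ. -/
lemma kummer_mapPoint [V.IsElliptic] [V'.IsElliptic] (f : F →+* K) (h : V.map f = V')
    {W P : V.Point} (hW : W ≠ 0) (hW' : ℓ • W = 0) (hP : ℓ • P ≠ 0) :
    kummer ℓ (mapPoint f h W) (mapPoint f h P) = f (kummer ℓ W P) := by
  rw [kummer, kummer, ← mapFun_divFun f h hP, ← mapFun_torsFun f h hW hW', val_mapFun,
    val_mapFun, map_div₀]

lemma kummer_pow [V.IsElliptic] {W P : V.Point} (hW : W ≠ 0) (hW' : ℓ • W = 0)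
    (hP : ℓ • P ≠ 0) : kummer ℓ W P ^ ℓ = val (-(ℓ • P)) (torsFun ℓ W) := by
  set f := algebraMap F (AlgebraicClosure F)
  have hV : V.map f = (V.map f).toAffine := rfl
  apply f.injective
  have h := kummer_pow_of_infinite (mapPoint_ne_zero f hV hW) (P := mapPoint f hV P)
    (by rw [← map_nsmul, hW', map_zero]) (by rw [← map_nsmul]; exact mapPoint_ne_zero f hV hP)
  rwa [kummer_mapPoint f hV hW hW' hP, ← mapFun_torsFun f hV hW hW', ← map_nsmul, ← map_neg,
    val_mapFun, ← map_pow] at h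

lemma kummer_ne_zero [V.IsElliptic] {W P : V.Point} (hℓ : ℓ ≠ 0) (hW : W ≠ 0) (hW' : ℓ • W = 0)
    (hP : ℓ • P ≠ 0) (hPW : ℓ • P ≠ -W) : kummer ℓ W P ≠ 0 := by
  rw [← pow_ne_zero_iff hℓ, kummer_pow hW hW' hP]
  exact val_torsFun_ne_zero hW hW' fun h => hPW (by rw [← h, neg_neg])

end Kummer

/-! ### The pairing on torsion points -/

section Pairing

variable {F : Type*} [Field F] {V : WeierstrassCurve.Affine F} {ℓ : ℕ}

variable (ℓ) in
/-- The pairing of two different nonzero torsion points. -/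
def pairing (T W : V.Point) : F := (-1) ^ ℓ * val W (torsFun ℓ T) / val T (torsFun ℓ W)

variable [V.IsElliptic]

/-- Equal points are excluded because `torsFun ℓ T` vanishes at `T`, so the defining quotient
degenerates. -/
lemma pairing_mul_pairing {T W : V.Point} (hT : T ≠ 0) (hT' : ℓ • T = 0) (hW : W ≠ 0)
    (hW' : ℓ • W = 0) (hTW : T ≠ W) : pairing ℓ T W * pairing ℓ W T = 1 := by
  have h1 := val_torsFun_ne_zero hT hT' hTW.symm
  have h2 := val_torsFun_ne_zero hW hW' hTW
  have h3 : ((-1 : F) ^ ℓ) * (-1) ^ ℓ = 1 := by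
    rw [← pow_add]; exact Even.neg_one_pow (by simp)
  rw [pairing, pairing]
  field_simp
  linear_combination h3

lemma mapPoint_pairing {K : Type*} [Field K] {V' : WeierstrassCurve.Affine K} [V'.IsElliptic]
    (f : F →+* K) (h : V.map f = V') {T W : V.Point} (hT : T ≠ 0) (hT' : ℓ • T = 0) (hW : W ≠ 0)
    (hW' : ℓ • W = 0) : pairing ℓ (mapPoint f h T) (mapPoint f h W) = f (pairing ℓ T W) := by
  rw [pairing, pairing, ← mapFun_torsFun f h hT hT', ← mapFun_torsFun f h hW hW', val_mapFun,
    val_mapFun, map_div₀, map_mul, map_pow, map_neg, map_one]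

variable (ℓ) in
/-- Translation by `T` multiplies the Kummer function of `W` by the constant `c`. -/
def Translates (W T : V.Point) (c : F) : Prop :=
  ∀ P : V.Point, ℓ • P ≠ 0 → ℓ • P ≠ -W → kummer ℓ W (P + T) = c * kummer ℓ W P

omit [V.IsElliptic] in
lemma Translates.add {W T T' : V.Point} {c c' : F} (hT : ℓ • T = 0)
    (h : Translates ℓ W T c) (h' : Translates ℓ W T' c') :
    Translates ℓ W (T + T') (c * c') := by
  intro P hP hPW
  have e : ℓ • (P + T) = ℓ • P := by rw [smul_add, hT, add_zero]
  rw [← add_assoc, h' _ (by rwa [e]) (by rwa [e]), h _ hP hPW]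
  ring

omit [V.IsElliptic] in
lemma translates_zero (W : V.Point) : Translates ℓ W 0 1 := fun P _ _ => by
  rw [add_zero, one_mul]

omit [V.IsElliptic] in
lemma Translates.nsmul {W T : V.Point} {c : F} (hT : ℓ • T = 0) (h : Translates ℓ W T c) (n : ℕ) :
    Translates ℓ W (n • T) (c ^ n) := by
  induction n with
  | zero => simpa using translates_zero W
  | succ n ih =>
    rw [succ_nsmul, pow_succ]
    exact ih.add (by rw [smul_comm, hT, smul_zero]) h

lemma Translates.unique {W T : V.Point} {c c' : F} (hℓ : ℓ ≠ 0) (hW : W ≠ 0) (hW' : ℓ • W = 0)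
    {P : V.Point} (hP : ℓ • P ≠ 0) (hPW : ℓ • P ≠ -W)
    (h : Translates ℓ W T c) (h' : Translates ℓ W T c') : c = c' :=
  mul_right_cancel₀ (kummer_ne_zero hℓ hW hW' hP hPW) ((h P hP hPW).symm.trans (h' P hP hPW))

/-- Both sides have the same zeros: the line contributes `P`, `T`, `-(P + T)` and the vertical `P +
T`, `-(P + T)`, each `ℓ` times, while ℓ(P + T) = ℓP. -/
lemma divFun_add {P T : V.Point} (hT : T ≠ 0) (hT' : ℓ • T = 0) (hP : ℓ • P ≠ 0) :
    divFun ℓ (P + T) * line P T ^ ℓ = divFun ℓ P * torsFun ℓ T * vert (P + T) ^ ℓ := by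
  have e : ℓ • (P + T) = ℓ • P := by rw [smul_add, hT', add_zero]
  have hP0 : P ≠ 0 := by rintro rfl; exact hP (smul_zero _)
  have hPT : P + T ≠ 0 := by intro h; rw [← e, h, smul_zero] at hP; exact hP rfl
  have h1 := isFun_divFun hP
  have h2 := isFun_divFun (P := P + T) (by rwa [e])
  have h3 := isFun_torsFun hT hT'
  refine (h2.monicAt.mul ((monicAt_line P T).pow ℓ)).eq_of_span_eq
    ((h1.monicAt.mul h3.monicAt).mul ((monicAt_vert _).pow ℓ)) ?_
  simp only [← Ideal.span_singleton_mul_span_singleton, ← Ideal.span_singleton_pow, h1.span_eq,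
    h2.span_eq, h3.span_eq, prod_divSeq, ← pointIdeal_mul_mul hP0 hT hPT, ← pointIdeal_neg_mul hPT, e,
    Finset.prod_const, Finset.card_range, mul_pow]
  ring

/-- Evaluate `divFun_add` at `W`. Reciprocity of `torsFun ℓ W` with the line and with the vertical
rewrites their `ℓ`-th powers at `W` as values of h_W at `P`, `T` and ±(P + T); all that depends on
`P` is absorbed by the two κ. -/
lemma translates_pairing [Infinite V.Point] {T W : V.Point} (hT : T ≠ 0) (hT' : ℓ • T = 0)
    (hW : W ≠ 0) (hW' : ℓ • W = 0) (hTW : T ≠ W) : Translates ℓ W T (pairing ℓ T W) := by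
  intro P hP hPW
  have e : ℓ • (P + T) = ℓ • P := by rw [smul_add, hT', add_zero]
  have hP0 : P ≠ 0 := by rintro rfl; exact hP (smul_zero _)
  have hPT : P + T ≠ 0 := by intro h; rw [← e, h, smul_zero] at hP; exact hP rfl
  have hg := isFun_torsFun hW hW'
  have k1 := congr_arg (val W) (divFun_add hT hT' hP)
  simp only [map_mul, map_pow] at k1
  have k2 := hg.line_reciprocity hP0 hT hPT
  have k3 := hg.vert_reciprocity hPT
  simp only [Finset.prod_const, Finset.card_range] at k2 k3
  have tors : ∀ {R : V.Point}, ℓ • R ≠ 0 → R ≠ W := by rintro R hR rfl; exact hR hW'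
  have n1 := val_torsFun_ne_zero hW hW' (tors hP)
  have n2 := val_torsFun_ne_zero hW hW' (tors (R := P + T) (by rwa [e]))
  have n3 := val_torsFun_ne_zero hW hW' hTW
  have n4 := val_torsFun_ne_zero hW hW' (tors (R := -(P + T))
    (by rwa [smul_neg, e, neg_ne_zero]))
  have hsq : ((-1 : F) ^ ℓ) * (-1) ^ ℓ = 1 := by
    rw [← pow_add]; exact Even.neg_one_pow (by simp)
  rw [kummer, kummer, pairing, div_mul_div_comm, div_eq_div_iff n2 (mul_ne_zero n3 n1)]
  apply mul_left_cancel₀ n4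
  linear_combination (val W (divFun ℓ (P + T))) * k2 + (-1) ^ ℓ * k1 -
    (-1) ^ ℓ * val W (divFun ℓ P) * val W (torsFun ℓ T) * k3

end Pairing

end

section

/-! ### The pairing of a torsion point with itself -/

section Alternating

variable {F : Type*} [Field F] {V : WeierstrassCurve.Affine F} {ℓ : ℕ} [V.IsElliptic]

lemma torsFun_two {T : V.Point} (hT : T ≠ 0) (hT' : 2 • T = 0) : torsFun 2 T = vert T := by
  have h : -T = T := by rw [neg_eq_iff_add_eq_zero, ← two_nsmul, hT']
  refine (isFun_torsFun hT hT').monicAt.eq_of_span_eq (monicAt_vert T) ?_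
  rw [(isFun_torsFun hT hT').span_eq, ← pointIdeal_neg_mul hT, h]
  simp [sq]

lemma pairing_two {T W : V.Point} (hT : T ≠ 0) (hT' : 2 • T = 0) (hW : W ≠ 0)
    (hW' : 2 • W = 0) (hTW : T ≠ W) : pairing 2 T W = -1 := by
  have h := val_torsFun_ne_zero hW hW' hTW
  rw [pairing, div_eq_iff h, torsFun_two hT hT', torsFun_two hW hW', val_vert _ hW, val_vert _ hT]
  ring

lemma Translates.unique' [Infinite V.Point] (hsurj : ∀ Q : V.Point, ∃ P, ℓ • P = Q)
    {W T : V.Point} {c c' : F} (hℓ : ℓ ≠ 0) (hW : W ≠ 0) (hW' : ℓ • W = 0)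
    (h : Translates ℓ W T c) (h' : Translates ℓ W T c') : c = c' := by
  obtain ⟨Q, hQ⟩ := Infinite.exists_notMem_finset ({0, -W} : Finset V.Point)
  simp only [Finset.mem_insert, Finset.mem_singleton, not_or] at hQ
  obtain ⟨P, rfl⟩ := hsurj Q
  exact h.unique hℓ hW hW' hQ.1 hQ.2 h'

/-- The pairing is alternating. -/
lemma translates_self [Infinite V.Point] (hℓ : ℓ.Prime) (hsurj : ∀ Q : V.Point, ∃ P, ℓ • P = Q)
    {W T : V.Point} (hW' : ℓ • W = 0) (hT' : ℓ • T = 0)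
    (hT : T ∉ AddSubgroup.zmultiples W) (hW : W ≠ 0) : Translates ℓ W W 1 := by
  have aux : ∀ {R : V.Point}, R ∉ AddSubgroup.zmultiples W → R ≠ 0 ∧ R ≠ W ∧ R ≠ -W := by
    intro R hR
    refine ⟨?_, ?_, ?_⟩ <;> rintro rfl <;> apply hR
    · exact zero_mem _
    · exact AddSubgroup.mem_zmultiples _
    · exact neg_mem (AddSubgroup.mem_zmultiples _)
  have hWT : W - T ∉ AddSubgroup.zmultiples W := fun h =>
    hT (by simpa using sub_mem (AddSubgroup.mem_zmultiples W) h)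
  have hWT' : ℓ • (W - T) = 0 := by rw [smul_sub, hW', hT', sub_zero]
  -- The quotient defining the pairing is useless for `W` against itself, so the translation by `W`
  -- is split as `T` followed by `W - T`, both outside the subgroup of `W`.
  have t1 := translates_pairing (aux hT).1 hT' hW hW' (aux hT).2.1
  have t2 := translates_pairing (aux hWT).1 hWT' hW hW' (aux hWT).2.1
  have h0 := t1.add hT' t2
  rw [add_sub_cancel] at h0
  -- For `ℓ = 2` both factors are `-1`. The argument for odd `ℓ` compares `W` with `-W`, which must
  -- then be distinct.
  rcases hℓ.eq_two_or_odd' with rfl | hodd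
  · rw [pairing_two (aux hT).1 hT' hW hW' (aux hT).2.1,
      pairing_two (aux hWT).1 hWT' hW hW' (aux hWT).2.1] at h0
    simpa using h0
  set c := pairing ℓ T W * pairing ℓ (W - T) W with hc
  have hN : -W ≠ 0 := neg_ne_zero.mpr hW
  have hN' : ℓ • (-W) = 0 := by rw [smul_neg, hW', neg_zero]
  have hWN : W ≠ -W := by
    intro h
    have h2 : 2 • W = 0 := by rw [two_nsmul]; exact eq_neg_iff_add_eq_zero.mp h
    have := hodd.coprime_two_right
    have h3 := Nat.Coprime.gcd_eq_one this
    apply hW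
    rw [← AddMonoid.addOrderOf_eq_one_iff, ← Nat.dvd_one, ← h3]
    exact Nat.dvd_gcd (addOrderOf_dvd_of_nsmul_eq_zero hW') (addOrderOf_dvd_of_nsmul_eq_zero h2)
  -- the multiplier of `-W` for a point `R` is inverse to that of `W`
  have key : ∀ {R : V.Point}, R ∉ AddSubgroup.zmultiples W → ℓ • R = 0 →
      pairing ℓ R (-W) * pairing ℓ R W = 1 := by
    intro R hR hR'
    obtain ⟨h1, h2, h3⟩ := aux hR
    have s1 := translates_pairing hN hN' h1 hR' h3.symm
    have s2 := translates_pairing hW hW' h1 hR' h2.symm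
    have s3 := s2.add hW' s1
    rw [add_neg_cancel] at s3
    have s4 := s3.unique' hsurj hℓ.ne_zero h1 hR' (translates_zero R)
    have s5 := pairing_mul_pairing hN hN' h1 hR' h3.symm
    have s6 := pairing_mul_pairing hW hW' h1 hR' h2.symm
    linear_combination (-(pairing ℓ R (-W) * pairing ℓ R W)) * s4 +
      (pairing ℓ W R * pairing ℓ R W) * s5 + s6
  have u1 := translates_pairing (aux hT).1 hT' hN hN' (aux hT).2.2
  have u2 := translates_pairing (aux hWT).1 hWT' hN hN' (aux hWT).2.2
  have u3 := u1.add hT' u2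
  rw [add_sub_cancel] at u3
  have u4 := u3.unique' hsurj hℓ.ne_zero hN hN' (translates_pairing hW hW' hN hN' hWN)
  have v1 := h0.add hW' (translates_pairing hN hN' hW hW' hWN.symm)
  rw [add_neg_cancel] at v1
  have v2 := v1.unique' hsurj hℓ.ne_zero hW hW' (translates_zero W)
  have v3 := pairing_mul_pairing hW hW' hN hN' hWN
  -- The constant `c` is inverse to e(W, -W) and to e(-W, W), which are inverse to each other.
  -- Together with `c ^ ℓ = 1` for odd `ℓ` this forces `c = 1`.
  have hc2 : c ^ 2 = 1 := by
    have e1 := key hT hT'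
    have e2 := key hWT hWT'
    have e3 : c * pairing ℓ W (-W) = 1 := by
      rw [← u4, hc]
      linear_combination (pairing ℓ (W - T) (-W) * pairing ℓ (W - T) W) * e1 + e2
    linear_combination (c ^ 2) * (-v3) + c * pairing ℓ (-W) W * e3 + v2
  have hcl : c ^ ℓ = 1 := by
    have := h0.nsmul hW' ℓ
    rw [hW'] at this
    exact this.unique' hsurj hℓ.ne_zero hW hW' (translates_zero W)
  have : c = 1 := by
    obtain ⟨m, rfl⟩ := hodd
    rw [pow_succ, pow_mul, hc2, one_pow, one_mul] at hcl
    exact hcl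
  rwa [this] at h0

end Alternating

end

section

/-! ### The abscissas of sums and differences -/

section AddSub

variable {F : Type*} [Field F] {V : WeierstrassCurve.Affine F}

lemma addX_mul_addX {x y x' y' : F} (h : V.Equation x y) (h' : V.Equation x' y') (hx : x' ≠ x) :
    V.addX x' x (V.slope x' x y' y) * V.addX x' x (V.slope x' x y' (V.negY x y)) * (x' - x) ^ 2 =
      (x' * x) ^ 2 - V.b₄ * (x' * x) - V.b₆ * (x' + x) - V.b₈ ∧
    (V.addX x' x (V.slope x' x y' y) + V.addX x' x (V.slope x' x y' (V.negY x y))) *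
        (x' - x) ^ 2 =
      2 * (x' + x) * (x' * x) + V.b₂ * (x' * x) + V.b₄ * (x' + x) + V.b₆ := by
  have hd : x' - x ≠ 0 := sub_ne_zero.mpr hx
  have e := (equation_iff' ..).mp h
  have e' := (equation_iff' ..).mp h'
  rw [slope_of_X_ne hx, slope_of_X_ne hx]
  set m := (y' - y) / (x' - x) with hm0
  set m' := (y' - V.negY x y) / (x' - x) with hm'0
  have hm : m * (x' - x) = y' - y := div_mul_cancel₀ _ hd
  have hm' : m' * (x' - x) = y' + y + V.a₁ * x + V.a₃ := by
    rw [hm'0, div_mul_cancel₀ _ hd, negY]; ring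
  -- The difference of the two Weierstrass equations makes the product of the numerators of the
  -- slopes divisible by `x' - x`.
  have hmm : m * m' * (x' - x) = x' ^ 2 + x * x' + x ^ 2 + V.a₂ * (x + x') + V.a₄ - V.a₁ * y' := by
    apply mul_right_cancel₀ hd
    linear_combination (m' * (x' - x)) * hm + (y' - y) * hm' + e' - e
  simp only [addX, WeierstrassCurve.b₂, WeierstrassCurve.b₄, WeierstrassCurve.b₆,
    WeierstrassCurve.b₈]
  clear_value m m'
  constructor
  · calc _ = (m * m' * (x' - x)) ^ 2 + V.a₁ * (m * m' * (x' - x)) *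
          (m * (x' - x) + m' * (x' - x)) + V.a₁ ^ 2 * (x' - x) * (m * m' * (x' - x)) -
          (V.a₂ + x' + x) * ((m * (x' - x)) ^ 2 + (m' * (x' - x)) ^ 2) -
          V.a₁ * (V.a₂ + x' + x) * (x' - x) * (m * (x' - x) + m' * (x' - x)) +
          (V.a₂ + x' + x) ^ 2 * (x' - x) ^ 2 := by ring
      _ = _ := by
        rw [hmm, hm, hm']
        linear_combination (-(V.a₁ ^ 2 + 2 * (V.a₂ + x' + x))) * e' - 2 * (V.a₂ + x' + x) * e
  · calc _ = (m * (x' - x)) ^ 2 + (m' * (x' - x)) ^ 2 + V.a₁ * (x' - x) *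
          (m * (x' - x) + m' * (x' - x)) - 2 * (V.a₂ + x' + x) * (x' - x) ^ 2 := by ring
      _ = _ := by
        rw [hm, hm']
        linear_combination 2 * e' + 2 * e

lemma addX_self {x y : F} (h : V.Equation x y) (hy : y ≠ V.negY x y) :
    V.addX x x (V.slope x x y y) * (y - V.negY x y) ^ 2 =
      (x * x) ^ 2 - V.b₄ * (x * x) - V.b₆ * (x + x) - V.b₈ := by
  have hd : y - V.negY x y ≠ 0 := sub_ne_zero.mpr hy
  have e := (equation_iff' ..).mp h
  rw [slope_of_Y_ne rfl hy]
  set m := (3 * x ^ 2 + 2 * V.a₂ * x + V.a₄ - V.a₁ * y) / (y - V.negY x y)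
  have hm : m * (y - V.negY x y) = 3 * x ^ 2 + 2 * V.a₂ * x + V.a₄ - V.a₁ * y :=
    div_mul_cancel₀ _ hd
  simp only [addX, WeierstrassCurve.b₄, WeierstrassCurve.b₆, WeierstrassCurve.b₈]
  clear_value m
  calc _ = (m * (y - V.negY x y)) ^ 2 + V.a₁ * (m * (y - V.negY x y)) * (y - V.negY x y) -
        (V.a₂ + x + x) * (y - V.negY x y) ^ 2 := by ring
    _ = _ := by
      rw [hm, negY]
      linear_combination (-(V.a₁ ^ 2 + 4 * (V.a₂ + x + x))) * e

lemma sub_negY_sq {x y : F} (h : V.Equation x y) : (y - V.negY x y) ^ 2 =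
    2 * (x + x) * (x * x) + V.b₂ * (x * x) + V.b₄ * (x + x) + V.b₆ := by
  have e := (equation_iff' ..).mp h
  simp only [negY, WeierstrassCurve.b₂, WeierstrassCurve.b₄, WeierstrassCurve.b₆]
  linear_combination 4 * e

/-- The values at `P` and `Q` of the map describing `x(P + Q)` and `x(P - Q)`. -/
lemma exists_sym2x_add_sub [V.IsElliptic] (R : V.Point) {P : V.Point} (hP : P ≠ 0) :
    ∃ c : F, c ≠ 0 ∧ ∀ i, (WeierstrassCurve.addSubMap V i).eval (R.sym2x P) =
      c * (R + P).sym2x (R - P) i := by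
  rcases P with _ | ⟨x, y, h⟩
  · exact absurd rfl hP
  have self : ∃ c : F, c ≠ 0 ∧ ∀ i, (WeierstrassCurve.addSubMap V i).eval
      ((Point.some x y h).sym2x (.some x y h)) =
        c * (Point.some x y h + .some x y h).sym2x 0 i := by
    by_cases hy : y = V.negY x y
    · refine ⟨(WeierstrassCurve.addSubMap V 0).eval ((Point.some x y h).sym2x (.some x y h)), ?_, ?_⟩
      · intro h0
        apply WeierstrassCurve.addSubMap_ne_zero V (Point.sym2x_ne_zero (.some x y h) (.some x y h))
        have e := sub_negY_sq h.1
        rw [sub_eq_zero.mpr hy] at e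
        funext i
        fin_cases i
        · exact h0
        · simp [WeierstrassCurve.addSubMap]
          linear_combination -e
        · simp [WeierstrassCurve.addSubMap]
          ring
      · have e := sub_negY_sq h.1
        rw [Point.add_self_of_Y_eq hy, Point.sym2x_zero_zero]
        rw [sub_eq_zero.mpr hy] at e
        intro i
        fin_cases i
        · simp
        · simp [WeierstrassCurve.addSubMap]
          linear_combination -e
        · simp [WeierstrassCurve.addSubMap]
          ring
    · have e := sub_negY_sq h.1
      refine ⟨(y - V.negY x y) ^ 2, pow_ne_zero _ (sub_ne_zero.mpr hy), ?_⟩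
      have e' := addX_self h.1 hy
      rw [Point.add_self_of_Y_ne hy, Point.sym2x_some_zero]
      generalize V.addX x x (V.slope x x y y) = X₂ at *
      generalize (y - V.negY x y) ^ 2 = D at *
      intro i
      fin_cases i
      · simp [WeierstrassCurve.addSubMap]
        linear_combination -e'
      · simp [WeierstrassCurve.addSubMap]
        linear_combination -e
      · simp [WeierstrassCurve.addSubMap]
        ring
  rcases R with _ | ⟨x', y', h'⟩
  · refine ⟨1, one_ne_zero, ?_⟩
    rw [← Point.zero_def, zero_add, zero_sub, Point.sym2x_zero_some, Point.sym2x_neg_right,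
      Point.sym2x_some_some]
    intro i
    fin_cases i <;> simp [WeierstrassCurve.addSubMap] <;> ring
  by_cases hx : x' = x
  · rcases (Point.X_eq_iff (h₁ := h') (h₂ := h)).mp hx with hR | hR
    · rw [hR, sub_self]
      exact self
    · rw [hR, neg_add_cancel, Point.sym2x_neg_left, ← neg_add', Point.sym2x_neg_right,
        Point.sym2x_comm 0]
      exact self
  · obtain ⟨e1, e2⟩ := addX_mul_addX h.1 h'.1 hx
    refine ⟨(x' - x) ^ 2, pow_ne_zero _ (sub_ne_zero.mpr hx), ?_⟩
    rw [sub_eq_add_neg (Point.some x' y' h'), Point.neg_some, Point.add_of_X_ne hx,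
      Point.add_of_X_ne hx, Point.sym2x_some_some, Point.sym2x_some_some]
    generalize V.addX x' x (V.slope x' x y' y) = X₁ at *
    generalize V.addX x' x (V.slope x' x y' (V.negY x y)) = X₂ at *
    intro i
    fin_cases i
    · simp [WeierstrassCurve.addSubMap]
      linear_combination -e1
    · simp [WeierstrassCurve.addSubMap]
      linear_combination -e2
    · simp [WeierstrassCurve.addSubMap]
      ring

end AddSub

end

section

/-! ### Multiplication by `n` on abscissas -/

universe u

section Multiplication

variable {k : Type u} [Field k]

/-- `A / B` describes the abscissa of `n • P` in terms of that of `P`, over every extension. -/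
structure IsMulPair (E : WeierstrassCurve.Affine k) (n : ℕ) (A B : k[X]) : Prop where
  isCoprime : IsCoprime A B
  monic : A.Monic
  natDegree_eq : A.natDegree = n ^ 2
  degree_lt : B.degree < (n ^ 2 : ℕ)
  xRep : ∀ {K : Type u} [Field K] (f : k →+* K) (V : WeierstrassCurve.Affine K), E.map f = V →
    ∀ P : V.Point, P ≠ 0 → ∃ c : K, c ≠ 0 ∧
      A.eval₂ f (xCoord P) = c * (n • P).xRep 0 ∧ B.eval₂ f (xCoord P) = c * (n • P).xRep 1

lemma xRep_eq {V : WeierstrassCurve.Affine k} {P : V.Point} (hP : P ≠ 0) :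
    P.xRep = ![xCoord P, 1] := by
  rcases P with _ | ⟨x, y, h⟩
  · exact absurd rfl hP
  · rfl

lemma isMulPair_zero (E : WeierstrassCurve.Affine k) : IsMulPair E 0 1 0 where
  isCoprime := isCoprime_one_left
  monic := monic_one
  natDegree_eq := by simp
  degree_lt := by simp
  xRep f V h P hP := ⟨1, one_ne_zero, by simp⟩

lemma isMulPair_one (E : WeierstrassCurve.Affine k) : IsMulPair E 1 X 1 where
  isCoprime := isCoprime_one_right
  monic := monic_X
  natDegree_eq := by simp
  degree_lt := by simp
  xRep f V h P hP := ⟨1, one_ne_zero, by simp [xRep_eq hP]⟩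

lemma eval_addSubMap (V : WeierstrassCurve.Affine k) (s t r : k) :
    (WeierstrassCurve.addSubMap V 0).eval ![s, t, r] =
      s ^ 2 - V.b₄ * s * r - V.b₆ * t * r - V.b₈ * r ^ 2 ∧
    (WeierstrassCurve.addSubMap V 1).eval ![s, t, r] =
      2 * s * t + V.b₂ * s * r + V.b₄ * t * r + V.b₆ * r ^ 2 ∧
    (WeierstrassCurve.addSubMap V 2).eval ![s, t, r] = t ^ 2 - 4 * s * r := by
  refine ⟨?_, ?_, ?_⟩ <;> simp [WeierstrassCurve.addSubMap]; try ring

/-- The sum and difference of (n + 1)P and P are (n + 2)P and nP. The symmetric functions of the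
abscissas of the latter pair are quadratic in those of the former; `s`, `t`, `B` are the former and
`G₀`, `G₁`, `G₂` the latter, up to scaling. Knowing `a` and `b`, one solves for (n + 2)P. -/
lemma exists_isMulPair_step (E : WeierstrassCurve.Affine k) [E.IsElliptic] {n : ℕ} {a b A B : k[X]}
    (hn : IsMulPair E n a b) (hn' : IsMulPair E (n + 1) A B) :
    ∃ R S : k[X], IsMulPair E (n + 2) R S := by
  set s := A * X with hs
  set t := A + X * B with ht
  set G₀ := s ^ 2 - C E.b₄ * s * B - C E.b₆ * t * B - C E.b₈ * B ^ 2 with hG₀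
  set G₁ := 2 * s * t + C E.b₂ * s * B + C E.b₄ * t * B + C E.b₆ * B ^ 2 with hG₁
  set G₂ := t ^ 2 - 4 * s * B with hG₂
  have key : ∀ {K : Type u} [Field K] (f : k →+* K) (V : WeierstrassCurve.Affine K), E.map f = V →
      ∀ P : V.Point, P ≠ 0 → ∃ c : K, c ≠ 0 ∧
      G₀.eval₂ f (xCoord P) = c * (((n + 2) • P).xRep 0 * a.eval₂ f (xCoord P)) ∧
      G₁.eval₂ f (xCoord P) = c * (((n + 2) • P).xRep 0 * b.eval₂ f (xCoord P) +
        ((n + 2) • P).xRep 1 * a.eval₂ f (xCoord P)) ∧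
      G₂.eval₂ f (xCoord P) = c * (((n + 2) • P).xRep 1 * b.eval₂ f (xCoord P)) := by
    intro K _ f V h P hP
    obtain ⟨c₁, hc₁, ea, eb⟩ := hn.xRep f V h P hP
    obtain ⟨c₂, hc₂, eA, eB⟩ := hn'.xRep f V h P hP
    subst h
    obtain ⟨c, hc, e⟩ := exists_sym2x_add_sub ((n + 1) • P) hP
    have h1 : (n + 1) • P + P = (n + 2) • P := by simp only [add_nsmul, one_nsmul, two_nsmul]; abel
    have h2 : (n + 1) • P - P = n • P := by simp only [add_nsmul, one_nsmul]; abel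
    rw [h1, h2] at e
    have e0 := e 0
    have e1 := e 1
    have e2 := e 2
    simp only [Point.sym2x] at e0 e1 e2
    obtain ⟨g0, g1, g2⟩ := eval_addSubMap (E.map f) (((n + 1) • P).xRep 0 * P.xRep 0)
      (((n + 1) • P).xRep 0 * P.xRep 1 + ((n + 1) • P).xRep 1 * P.xRep 0)
      (((n + 1) • P).xRep 1 * P.xRep 1)
    rw [g0] at e0
    rw [g1] at e1
    rw [g2] at e2
    simp only [xRep_eq hP, Matrix.cons_val_zero, Matrix.cons_val_one, mul_one,
      WeierstrassCurve.map_b₂, WeierstrassCurve.map_b₄, WeierstrassCurve.map_b₆,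
      WeierstrassCurve.map_b₈, Matrix.cons_val] at e0 e1 e2
    -- The quadratic forms scale by `c₂ ^ 2`, and replacing the representative of nP by `a`, `b`
    -- costs `c₁`.
    refine ⟨c₂ ^ 2 * c / c₁, by positivity, ?_, ?_, ?_⟩
    all_goals
      simp only [hG₀, hG₁, hG₂, hs, ht, eval₂_add, eval₂_sub, eval₂_mul, eval₂_pow, eval₂_C, eval₂_X,
        eval₂_ofNat, ea, eb, eA, eB]
      field_simp
    · linear_combination e0
    · linear_combination e1
    · linear_combination e2
  -- If (G₀, G₁, G₂) = (xa, xb + za, zb), then b G₁ - a G₂ = x b² and a G₁ - b G₀ = z a², so the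
  -- Bézout relations recover x and z without division.
  obtain ⟨u, v, huv⟩ : IsCoprime a (b ^ 2) := hn.isCoprime.pow_right
  obtain ⟨u', v', huv'⟩ : IsCoprime b (a ^ 2) := hn.isCoprime.symm.pow_right
  set R := u * G₀ + v * (b * G₁ - a * G₂) with hR
  set S := u' * G₂ + v' * (a * G₁ - b * G₀) with hS
  have key' : ∀ {K : Type u} [Field K] (f : k →+* K) (V : WeierstrassCurve.Affine K), E.map f = V →
      ∀ P : V.Point, P ≠ 0 → ∃ c : K, c ≠ 0 ∧
      R.eval₂ f (xCoord P) = c * ((n + 2) • P).xRep 0 ∧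
      S.eval₂ f (xCoord P) = c * ((n + 2) • P).xRep 1 ∧
      (R * a).eval₂ f (xCoord P) = G₀.eval₂ f (xCoord P) ∧
      (S * a + R * b).eval₂ f (xCoord P) = G₁.eval₂ f (xCoord P) := by
    intro K _ f V h P hP
    obtain ⟨c, hc, e0, e1, e2⟩ := key f V h P hP
    have w := congr_arg (eval₂ f (xCoord P)) huv
    have w' := congr_arg (eval₂ f (xCoord P)) huv'
    simp only [eval₂_add, eval₂_mul, eval₂_pow, eval₂_one] at w w'
    have r : R.eval₂ f (xCoord P) = c * ((n + 2) • P).xRep 0 := by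
      simp only [hR, eval₂_add, eval₂_sub, eval₂_mul, e0, e1, e2]
      linear_combination c * ((n + 2) • P).xRep 0 * w
    have s : S.eval₂ f (xCoord P) = c * ((n + 2) • P).xRep 1 := by
      simp only [hS, eval₂_add, eval₂_sub, eval₂_mul, e0, e1, e2]
      linear_combination c * ((n + 2) • P).xRep 1 * w'
    refine ⟨c, hc, r, s, ?_, ?_⟩
    · rw [eval₂_mul, e0, r]; ring
    · rw [eval₂_add, eval₂_mul, eval₂_mul, e1, r, s]; ring
  -- Over the closure every element is an abscissa, so polynomials agreeing at all abscissas are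
  -- equal.
  have ext_of : ∀ p q : k[X], (∀ (P : (E.map (algebraMap k (AlgebraicClosure k))).toAffine.Point), P ≠ 0 →
      p.eval₂ (algebraMap k (AlgebraicClosure k)) (xCoord P) = q.eval₂ (algebraMap k (AlgebraicClosure k)) (xCoord P)) → p = q := by
    intro p q h
    apply map_injective _ (algebraMap k (AlgebraicClosure k)).injective
    apply Polynomial.funext
    intro x
    obtain ⟨P, hP, rfl⟩ := exists_point (V := E.map (algebraMap k (AlgebraicClosure k))) x
    rw [eval_map, eval_map]
    exact h P hP
  have hRa : R * a = G₀ := ext_of _ _ fun P hP => by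
    obtain ⟨c, -, -, -, h, -⟩ := key' _ _ rfl P hP
    exact h
  have hSa : S * a + R * b = G₁ := ext_of _ _ fun P hP => by
    obtain ⟨c, -, -, -, -, h⟩ := key' _ _ rfl P hP
    exact h
  set N := (n + 1) ^ 2 with hN
  -- Degrees are read off from `R * a = G₀`, monic of degree `2 * N + 2`, and from `S * a = G₁ - R *
  -- b`, of degree at most `2 * N + 1`.
  have hN1 : 2 * N + 2 = (n + 2) ^ 2 + n ^ 2 := by rw [hN]; ring
  have hN0 : 0 < N := by positivity
  have dA : A.natDegree ≤ N := hn'.natDegree_eq.le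
  have dB : B.natDegree + 1 ≤ N := by
    by_cases hB : B = 0
    · rw [hB, natDegree_zero]; omega
    · exact (natDegree_lt_iff_degree_lt hB).mpr hn'.degree_lt
  have ds : s.Monic ∧ s.natDegree = N + 1 := by
    refine ⟨hn'.monic.mul monic_X, ?_⟩
    rw [hs, hn'.monic.natDegree_mul monic_X, hn'.natDegree_eq, natDegree_X]
  have dt : t.natDegree ≤ N :=
    natDegree_add_le_of_degree_le dA <| natDegree_mul_le.trans <| by rw [natDegree_X]; omega
  have dC : ∀ (c : k) {p q : k[X]} {d e m : ℕ}, p.natDegree ≤ d → q.natDegree ≤ e → d + e ≤ m →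
      (C c * p * q).natDegree ≤ m := fun c p q d e m hp hq h =>
    (natDegree_mul_le_of_le ((natDegree_C_mul_le c p).trans hp) hq).trans h
  have dC' : ∀ (c : k) {m : ℕ}, 2 * N ≤ m → (C c * B ^ 2).natDegree ≤ m := fun c m h => by
    rw [pow_two, ← mul_assoc]
    exact dC c (by omega : B.natDegree ≤ N) (by omega : B.natDegree ≤ N) (by omega)
  have hB' : B.natDegree ≤ N := by omega
  have d0 : G₀.Monic ∧ G₀.natDegree = 2 * N + 2 := by
    have h1 : (s ^ 2).natDegree = 2 * N + 2 := by rw [ds.1.natDegree_pow, ds.2]; ring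
    have h2 : (-(C E.b₄ * s * B + C E.b₆ * t * B + C E.b₈ * B ^ 2)).natDegree < 2 * N + 2 := by
      rw [natDegree_neg, Nat.lt_succ_iff]
      exact natDegree_add_le_of_degree_le (natDegree_add_le_of_degree_le
        (dC _ ds.2.le hB' (by omega)) (dC _ dt hB' (by omega))) (dC' _ (by omega))
    have h3 : G₀ = s ^ 2 + -(C E.b₄ * s * B + C E.b₆ * t * B + C E.b₈ * B ^ 2) := by
      rw [hG₀]; ring
    rw [h3]
    exact ⟨monic_add_of_natDegree_lt (ds.1.pow 2) h1 (.inr h2) |>.1,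
      monic_add_of_natDegree_lt (ds.1.pow 2) h1 (.inr h2) |>.2⟩
  have d1 : G₁.natDegree ≤ 2 * N + 1 := by
    refine natDegree_add_le_of_degree_le (natDegree_add_le_of_degree_le
      (natDegree_add_le_of_degree_le ?_ (dC _ ds.2.le hB' (by omega)))
      (dC _ dt hB' (by omega))) (dC' _ (by omega))
    exact dC 2 ds.2.le dt (by omega)
  have hRm : R.Monic := hn.monic.of_mul_monic_right (hRa ▸ d0.1)
  have dR : R.natDegree = (n + 2) ^ 2 := by
    have := d0.2
    rw [← hRa, hRm.natDegree_mul hn.monic, hn.natDegree_eq] at this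
    omega
  refine ⟨R, S, ?_, hRm, dR, ?_, fun f V h P hP => ?_⟩
  · refine (isCoprime_iff_aeval_ne_zero_of_isAlgClosed k (AlgebraicClosure k) R S).mpr fun x => ?_
    obtain ⟨P, hP, rfl⟩ :=
      exists_point (V := (E.map (algebraMap k (AlgebraicClosure k))).toAffine) x
    obtain ⟨c, hc, e0, e1, -⟩ := key' _ _ rfl P hP
    rw [aeval_def, aeval_def, e0, e1]
    by_contra! h
    apply Point.xRep_ne_zero ((n + 2) • P)
    funext i
    fin_cases i
    · exact (mul_eq_zero.mp h.1).resolve_left hc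
    · exact (mul_eq_zero.mp h.2).resolve_left hc
  · by_cases hS0 : S = 0
    · rw [hS0, degree_zero]; exact WithBot.bot_lt_coe _
    rw [← natDegree_lt_iff_degree_lt hS0]
    have hRb : (R * b).natDegree ≤ 2 * N + 1 := by
      by_cases hb : b = 0
      · simp [hb]
      · have := (natDegree_lt_iff_degree_lt hb).mpr hn.degree_lt
        refine natDegree_mul_le.trans ?_
        omega
    have h1 : (S * a).natDegree ≤ 2 * N + 1 := by
      rw [eq_sub_of_add_eq hSa]
      exact (natDegree_sub_le _ _).trans (max_le d1 hRb)
    rw [natDegree_mul hS0 hn.monic.ne_zero, hn.natDegree_eq] at h1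
    omega
  · obtain ⟨c, hc, e0, e1, -⟩ := key' f V h P hP
    exact ⟨c, hc, e0, e1⟩

theorem exists_isMulPair (E : WeierstrassCurve.Affine k) [E.IsElliptic] (n : ℕ) :
    ∃ A B : k[X], IsMulPair E n A B := by
  induction n using Nat.twoStepInduction with
  | zero => exact ⟨_, _, isMulPair_zero E⟩
  | one => exact ⟨_, _, isMulPair_one E⟩
  | more n ih ih' =>
    obtain ⟨a, b, h⟩ := ih
    obtain ⟨A, B, h'⟩ := ih'
    exact exists_isMulPair_step E h h'

end Multiplication

end

section

/-! ### Divisibility and torsion -/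

section Torsion

universe u

variable {k K : Type u} [Field k] [Field K] {E : WeierstrassCurve.Affine k} {n : ℕ} {A B : k[X]}

lemma eq_or_eq_neg_of_xCoord {P Q : E.Point} (hP : P ≠ 0) (hQ : Q ≠ 0)
    (h : xCoord P = xCoord Q) : P = Q ∨ P = -Q :=
  Point.xRep_eq_xRep_iff.mp (by rw [xRep_eq hP, xRep_eq hQ, h])

lemma IsMulPair.eval_den_eq_zero_iff (h : IsMulPair E n A B) (f : k →+* K)
    {V : WeierstrassCurve.Affine K} (hV : E.map f = V) {P : V.Point} (hP : P ≠ 0) :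
    B.eval₂ f (xCoord P) = 0 ↔ n • P = 0 := by
  obtain ⟨c, hc, -, e⟩ := h.xRep f V hV P hP
  rw [e, mul_eq_zero, or_iff_right hc]
  refine ⟨fun h0 => ?_, fun h0 => by simp [h0]⟩
  by_contra hn
  simp [xRep_eq hn] at h0

lemma IsMulPair.eval_num_eq (h : IsMulPair E n A B) (f : k →+* K)
    {V : WeierstrassCurve.Affine K} (hV : E.map f = V) {P : V.Point} (hP : P ≠ 0)
    (hn : n • P ≠ 0) : A.eval₂ f (xCoord P) = xCoord (n • P) * B.eval₂ f (xCoord P) := by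
  obtain ⟨c, hc, e, e'⟩ := h.xRep f V hV P hP
  rw [e, e', xRep_eq hn]
  simp [mul_comm]

lemma IsMulPair.den_ne_zero (h : IsMulPair E n A B) (hn : n ≠ 0) : B ≠ 0 := by
  rintro rfl
  have := natDegree_eq_zero_of_isUnit (isCoprime_zero_right.mp h.isCoprime)
  rw [h.natDegree_eq] at this
  exact hn (pow_eq_zero_iff two_ne_zero |>.mp this)

lemma IsMulPair.eval_den_ne_zero (h : IsMulPair E n A B) (f : k →+* K) {x t : K}
    (hx : A.eval₂ f x = t * B.eval₂ f x) : B.eval₂ f x ≠ 0 := by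
  intro h0
  obtain ⟨u, v, huv⟩ := h.isCoprime
  have := congr_arg (eval₂ f x) huv
  rw [eval₂_add, eval₂_mul, eval₂_mul, hx, h0] at this
  simp at this

lemma IsMulPair.monic_sub (h : IsMulPair E n A B) (t : k) :
    (A - C t * B).Monic ∧ (A - C t * B).natDegree = n ^ 2 := by
  have hA : A.degree = (n ^ 2 : ℕ) := by rw [degree_eq_natDegree h.monic.ne_zero, h.natDegree_eq]
  have hd : (C t * B).degree < A.degree := by
    rw [hA]
    by_cases ht : t = 0
    · simp only [ht, C_0, zero_mul, degree_zero]; exact WithBot.bot_lt_coe _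
    · rw [degree_C_mul ht]; exact h.degree_lt
  exact ⟨h.monic.sub_of_left hd, (natDegree_eq_of_degree_eq
    (degree_sub_eq_left_of_degree_lt hd)).trans h.natDegree_eq⟩

lemma IsMulPair.nsmul_eq_or_eq_neg (h : IsMulPair E n A B) {P Q : E.Point} (hP : P ≠ 0)
    (hQ : Q ≠ 0) (hx : (A - C (xCoord Q) * B).eval (xCoord P) = 0) :
    n • P = Q ∨ n • P = -Q := by
  rw [eval_sub, eval_mul, eval_C, sub_eq_zero] at hx
  have h0 := h.eval_den_ne_zero (RingHom.id k) hx
  have hn : n • P ≠ 0 := fun h' =>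
    h0 ((h.eval_den_eq_zero_iff (RingHom.id k) E.map_id hP).mpr h')
  refine eq_or_eq_neg_of_xCoord hn hQ (mul_right_cancel₀ h0 ?_)
  rw [← h.eval_num_eq (RingHom.id k) E.map_id hP hn]
  exact hx

lemma exists_nsmul_eq_xCoord [IsAlgClosed k] (h : IsMulPair E n A B) [E.IsElliptic]
    {Q : E.Point} (hQ : Q ≠ 0) {x : k} (hx : (A - C (xCoord Q) * B).eval x = 0) :
    ∃ P : E.Point, P ≠ 0 ∧ xCoord P = x ∧ n • P = Q := by
  obtain ⟨P, hP, rfl⟩ := exists_point (V := E) x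
  rcases h.nsmul_eq_or_eq_neg hP hQ hx with e | e
  · exact ⟨P, hP, rfl, e⟩
  · refine ⟨-P, neg_ne_zero.mpr hP, ?_, by rw [smul_neg, e, neg_neg]⟩
    rcases P with _ | _ <;> rfl

theorem exists_nsmul_eq [IsAlgClosed k] [E.IsElliptic] (hn : n ≠ 0) (Q : E.Point) :
    ∃ P : E.Point, n • P = Q := by
  obtain ⟨A, B, h⟩ := exists_isMulPair E n
  by_cases hQ : Q = 0
  · exact ⟨0, by rw [hQ, nsmul_zero]⟩
  obtain ⟨x, hx⟩ := IsAlgClosed.exists_root (A - C (xCoord Q) * B) (by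
    rw [degree_eq_natDegree (h.monic_sub _).1.ne_zero, (h.monic_sub _).2]
    exact_mod_cast pow_ne_zero 2 hn)
  obtain ⟨P, -, -, hP⟩ := exists_nsmul_eq_xCoord h hQ hx
  exact ⟨P, hP⟩

/-- If it vanished, coprimality would give `A ∣ A'`, hence `A' = 0`; but the coefficient of `A'` in
degree `n ^ 2 - 1` is `n ^ 2`, nonzero in `k`. -/
lemma IsMulPair.wronskian_ne_zero (h : IsMulPair E n A B) (hn : (n : k) ≠ 0) :
    derivative A * B - A * derivative B ≠ 0 := by
  intro h0
  have hn0 : n ≠ 0 := by rintro rfl; simp at hn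
  have hdvd : A ∣ derivative A :=
    h.isCoprime.dvd_of_dvd_mul_right ⟨derivative B, sub_eq_zero.mp h0⟩
  have hd : derivative A = 0 := by
    refine eq_zero_of_dvd_of_natDegree_lt hdvd (natDegree_derivative_lt ?_)
    rw [h.natDegree_eq]
    exact pow_ne_zero 2 hn0
  have hc := congr_arg (coeff · (n ^ 2 - 1)) hd
  have h1 : n ^ 2 - 1 + 1 = n ^ 2 := Nat.sub_add_cancel (Nat.pos_of_ne_zero (pow_ne_zero 2 hn0))
  simp only [coeff_derivative, coeff_zero] at hc
  rw [h1, ← h.natDegree_eq, h.monic.coeff_natDegree, one_mul, h.natDegree_eq,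
    ← Nat.cast_add_one, h1, Nat.cast_pow] at hc
  exact hn (pow_eq_zero_iff two_ne_zero |>.mp hc)

/-- A generic abscissa has `n ^ 2` distinct preimages under `A / B`. They lift to points with the
same multiple, whose differences from one of them are torsion. -/
theorem exists_torsion_finset [IsAlgClosed k] [E.IsElliptic] (hn : (n : k) ≠ 0) :
    ∃ S : Finset E.Point, S.card = n ^ 2 ∧ ∀ T ∈ S, n • T = 0 := by
  obtain ⟨A, B, h⟩ := exists_isMulPair E n
  have hn0 : n ≠ 0 := by rintro rfl; simp at hn
  have hD := h.wronskian_ne_zero hn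
  set D := derivative A * B - A * derivative B with hDdef
  -- The value `t` avoids the critical values of `A / B`: a double root of `A - t B` is a root of
  -- the Wronskian `D`.
  obtain ⟨t, ht⟩ := Infinite.exists_notMem_finset
    (D.roots.toFinset.image fun x => A.eval x / B.eval x)
  have hq := h.monic_sub t
  have hsep : (A - C t * B).Separable := by
    refine (isCoprime_iff_aeval_ne_zero_of_isAlgClosed k k _ _).mpr fun x => ?_
    by_contra! hx
    simp only [coe_aeval_eq_eval, eval_sub, eval_mul, eval_C, derivative_sub, derivative_mul,
      derivative_C, zero_mul, zero_add] at hx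
    have hB : B.eval x ≠ 0 := h.eval_den_ne_zero (RingHom.id k) (sub_eq_zero.mp hx.1)
    apply ht
    rw [Finset.mem_image]
    refine ⟨x, ?_, by rw [sub_eq_zero.mp hx.1, mul_div_cancel_right₀ _ hB]⟩
    rw [Multiset.mem_toFinset, mem_roots hD, IsRoot, hDdef, eval_sub, eval_mul, eval_mul]
    linear_combination B.eval x * hx.2 - (derivative B).eval x * hx.1
  obtain ⟨Q, hQ, rfl⟩ := exists_point (V := E) t
  set q := A - C (xCoord Q) * B with hqdef
  have hroot : ∀ x : k, ∃ P : E.Point, q.eval x = 0 → xCoord P = x ∧ n • P = Q := fun x => by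
    by_cases hx : q.eval x = 0
    · obtain ⟨P, -, h1, h2⟩ := exists_nsmul_eq_xCoord h hQ hx
      exact ⟨P, fun _ => ⟨h1, h2⟩⟩
    · exact ⟨0, fun h => absurd h hx⟩
  choose φ hφ using hroot
  have hcard : q.roots.toFinset.card = n ^ 2 := by
    rw [Multiset.toFinset_card_of_nodup (nodup_roots hsep), ← hq.2]
    exact (IsAlgClosed.splits q).natDegree_eq_card_roots.symm
  have hmem : ∀ x ∈ q.roots.toFinset, xCoord (φ x) = x ∧ n • φ x = Q := fun x hx =>
    hφ x ((mem_roots hq.1.ne_zero).mp (Multiset.mem_toFinset.mp hx))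
  obtain ⟨x₀, hx₀⟩ : q.roots.toFinset.Nonempty := by
    rw [← Finset.card_pos, hcard]; positivity
  refine ⟨q.roots.toFinset.image fun x => φ x - φ x₀, ?_, ?_⟩
  · rw [Finset.card_image_of_injOn, hcard]
    intro x hx y hy e
    rw [← (hmem x hx).1, ← (hmem y hy).1, sub_left_injective e]
  · intro T hT
    obtain ⟨x, hx, rfl⟩ := Finset.mem_image.mp hT
    rw [nsmul_sub, (hmem x hx).2, (hmem x₀ hx₀).2, sub_self]

/-- Torsion points are defined over any algebraically closed field of definition. -/
lemma exists_mapPoint_eq_of_torsion [IsAlgClosed k] [E.IsElliptic] (hn : n ≠ 0) (f : k →+* K)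
    {V : WeierstrassCurve.Affine K} (hV : E.map f = V) {T : V.Point} (hT : n • T = 0) :
    ∃ T₀ : E.Point, n • T₀ = 0 ∧ mapPoint f hV T₀ = T := by
  obtain ⟨A, B, h⟩ := exists_isMulPair E n
  by_cases hT0 : T = 0
  · exact ⟨0, nsmul_zero _, by rw [map_zero, hT0]⟩
  have hx := (h.eval_den_eq_zero_iff f hV hT0).mpr hT
  obtain ⟨x, hx⟩ : xCoord T ∈ f.range := by
    refine (IsAlgClosed.splits B).mem_range_of_isRoot (h.den_ne_zero hn) ?_
    rwa [IsRoot, eval_map]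
  obtain ⟨P, hP, rfl⟩ := exists_point (V := E) x
  rw [← xCoord_mapPoint f hV] at hx
  have key : ∃ T₀ : E.Point, mapPoint f hV T₀ = T := by
    rcases eq_or_eq_neg_of_xCoord (mapPoint_ne_zero f hV hP) hT0 hx with e | e
    · exact ⟨P, e⟩
    · exact ⟨-P, by rw [map_neg, e, neg_neg]⟩
  obtain ⟨T₀, rfl⟩ := key
  refine ⟨T₀, mapPoint_injective f hV ?_, rfl⟩
  rw [map_nsmul, hT, map_zero]

end Torsion

end

section

/-! ### Roots of functions in the function field -/

section Roots

variable {F : Type*} [Field F] {V : WeierstrassCurve.Affine F}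

lemma algebraMap_mul_smul_basis' (d p q : F[X]) :
    algebraMap F[X] V.CoordinateRing d *
      (p • (1 : V.CoordinateRing) + q • CoordinateRing.mk V Y) =
      (d * p) • (1 : V.CoordinateRing) + (d * q) • CoordinateRing.mk V Y := by
  rw [← Algebra.smul_def, smul_add, mul_smul, mul_smul]

lemma val_algebraMap_polynomial {P : V.Point} (hP : P ≠ 0) (d : F[X]) :
    val P (algebraMap F[X] V.CoordinateRing d) = d.eval (xCoord P) := by
  have := val_smul_basis hP d 0
  rwa [zero_smul, add_zero, eval_zero, zero_mul, add_zero, ← Algebra.algebraMap_eq_smul_one] at this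

/-- The discriminant polynomial of `V` as a quadratic equation in `Y` has no multiple roots. -/
lemma not_sq_dvd_disc [V.IsElliptic] (h2 : (2 : F) ≠ 0) (r : F) :
    ¬ (X - C r) ^ 2 ∣ (C V.a₁ * X + C V.a₃) ^ 2 +
      4 * (X ^ 3 + C V.a₂ * X ^ 2 + C V.a₄ * X + C V.a₆) := by
  rintro ⟨g, hg⟩
  have e := congr_arg (eval r) hg
  have e' := congr_arg (fun f => eval r (derivative f)) hg
  simp only [derivative_mul, derivative_add, derivative_pow, derivative_sub, derivative_X,
    derivative_C, derivative_ofNat, eval_add, eval_mul, eval_pow, eval_sub, eval_X, eval_C, sub_self,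
    eval_ofNat, eval_zero, eval_one, map_natCast, eval_natCast] at e e'
  norm_num at e e'
  set y := -(V.a₁ * r + V.a₃) / 2 with hy
  have hy2 : 2 * y = -(V.a₁ * r + V.a₃) := mul_div_cancel₀ _ h2
  have hE : V.Equation r y := by
    rw [equation_iff']
    have h4 : (2 : F) * 2 ≠ 0 := mul_ne_zero h2 h2
    refine (mul_eq_zero.mp ?_).resolve_left h4
    linear_combination (2 * y + V.a₁ * r + V.a₃) * hy2 - e
  have hN := (nonsingular_iff' ..).mp (equation_iff_nonsingular.mp hE)
  rcases hN.2 with h | h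
  · apply h
    refine (mul_eq_zero.mp ?_).resolve_left (mul_ne_zero h2 h2)
    linear_combination (2 * V.a₁) * hy2 - e'
  · exact h (by linear_combination hy2)

/-- This is normality of the affine curve, done by hand. Write `w = p + q y`; it vanishes at both
points above `r`, so `X - r` divides its trace, and the hypothesis puts `(X - r) ^ 2` into its norm.
Since trace² - 4 norm is `q ^ 2` times the squarefree discriminant, `X - r` divides `q`, and then
`p`. -/
lemma exists_linear_factor_cancel [V.IsElliptic] [IsAlgClosed F] (h2 : (2 : F) ≠ 0) {ℓ : ℕ}
    (hℓ : ℓ ≠ 0) {w g : V.CoordinateRing} {d : F[X]} (r : F)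
    (h : w ^ ℓ = g * algebraMap F[X] V.CoordinateRing ((X - C r) * d) ^ ℓ) :
    ∃ w', w = algebraMap F[X] V.CoordinateRing (X - C r) * w' := by
  obtain ⟨p, q, rfl⟩ := CoordinateRing.exists_smul_basis_eq w
  obtain ⟨P, hP, hPr⟩ := exists_point (V := V) r
  have hval : ∀ P : V.Point, P ≠ 0 → xCoord P = r →
      val P (p • (1 : V.CoordinateRing) + q • CoordinateRing.mk V Y) = 0 := fun P hP hPr => by
    have := congr_arg (val P) h
    rw [map_mul, map_pow, map_pow, val_algebraMap_polynomial hP, hPr] at this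
    simp only [eval_mul, eval_sub, eval_X, eval_C, sub_self, zero_mul, zero_pow hℓ, mul_zero] at this
    exact pow_eq_zero_iff hℓ |>.mp this
  have h1 := hval P hP hPr
  have h1' := hval (-P) (neg_ne_zero.mpr hP) (by rw [← hPr]; rcases P with _ | _ <;> rfl)
  rw [val_smul_basis hP] at h1
  rw [val_smul_basis (neg_ne_zero.mpr hP)] at h1'
  have hs : (X - C r) ∣ 2 * p - q * (C V.a₁ * X + C V.a₃) := by
    rw [dvd_iff_isRoot, IsRoot]
    rcases P with _ | ⟨x, y, hxy⟩
    · exact absurd rfl hP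
    · obtain rfl : x = r := hPr
      simp only [Point.neg_some, xCoord, yCoord, negY] at h1 h1'
      simp only [eval_sub, eval_mul, eval_ofNat, eval_add, eval_C, eval_X]
      linear_combination h1 + h1'
  set N := Algebra.norm F[X] (p • (1 : V.CoordinateRing) + q • CoordinateRing.mk V Y) with hN
  have hN2 : (X - C r) ^ 2 ∣ N := by
    rw [← IsIntegrallyClosed.pow_dvd_pow_iff hℓ, hN, ← map_pow, h, map_mul, map_pow, Algebra.norm_algebraMap,
      Module.finrank_eq_card_basis (CoordinateRing.basis V), Fintype.card_fin]
    exact Dvd.dvd.mul_left (pow_dvd_pow_of_dvd (pow_dvd_pow_of_dvd (dvd_mul_right _ _) _) _) _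
  have hdisc : (X - C r) ^ 2 ∣ q ^ 2 * ((C V.a₁ * X + C V.a₃) ^ 2 +
      4 * (X ^ 3 + C V.a₂ * X ^ 2 + C V.a₄ * X + C V.a₆)) := by
    have : q ^ 2 * ((C V.a₁ * X + C V.a₃) ^ 2 + 4 * (X ^ 3 + C V.a₂ * X ^ 2 + C V.a₄ * X + C V.a₆))
        = (2 * p - q * (C V.a₁ * X + C V.a₃)) ^ 2 - 4 * N := by
      rw [hN, CoordinateRing.norm_smul_basis]
      ring
    rw [this]
    exact dvd_sub (pow_dvd_pow_of_dvd hs 2) (Dvd.dvd.mul_left hN2 _)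
  have hq : (X - C r) ∣ q := by
    by_contra hq
    have hc : IsCoprime ((X - C r) ^ 2) (q ^ 2) :=
      (((irreducible_X_sub_C r).coprime_iff_not_dvd).mpr hq).pow
    exact not_sq_dvd_disc h2 r (hc.dvd_of_dvd_mul_left hdisc)
  have hp : (X - C r) ∣ p := by
    have h2p : (X - C r) ∣ C 2 * p := by
      have := dvd_add hs (Dvd.dvd.mul_right hq (C V.a₁ * X + C V.a₃))
      rw [sub_add_cancel] at this
      exact this
    exact (isUnit_C.mpr (Ne.isUnit h2)).dvd_mul_left.mp h2p
  obtain ⟨p', rfl⟩ := hp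
  obtain ⟨q', rfl⟩ := hq
  exact ⟨_, (algebraMap_mul_smul_basis' _ p' q').symm⟩

theorem exists_pow_eq_of_pow_eq_mul [V.IsElliptic] [IsAlgClosed F] (h2 : (2 : F) ≠ 0) {ℓ : ℕ}
    (hℓ : ℓ ≠ 0) {g : V.CoordinateRing} {d : F[X]} (hd : d ≠ 0) {w : V.CoordinateRing}
    (h : w ^ ℓ = g * algebraMap F[X] V.CoordinateRing d ^ ℓ) : ∃ w', w' ^ ℓ = g := by
  have hinj : ∀ {d : F[X]}, d ≠ 0 → algebraMap F[X] V.CoordinateRing d ≠ 0 := fun {d} hd h0 => by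
    rw [Algebra.algebraMap_eq_smul_one] at h0
    have h1 : d • (1 : V.CoordinateRing) + (0 : F[X]) • CoordinateRing.mk V Y = 0 := by
      rw [h0, zero_smul, add_zero]
    exact hd (CoordinateRing.smul_basis_eq_zero h1).1
  induction hn : d.natDegree generalizing d w with
  | zero =>
    obtain ⟨c, rfl⟩ := natDegree_eq_zero.mp hn
    have hc : c ≠ 0 := by rintro rfl; simp at hd
    refine ⟨w * algebraMap F[X] V.CoordinateRing (C c⁻¹), ?_⟩
    rw [mul_pow, h, mul_assoc, ← mul_pow, ← map_mul, ← C_mul, mul_inv_cancel₀ hc, C_1, map_one,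
      one_pow, mul_one]
  | succ n ih =>
    obtain ⟨r, hr⟩ := IsAlgClosed.exists_root d (by
      rw [degree_eq_natDegree hd, hn]; exact_mod_cast n.succ_ne_zero)
    obtain ⟨d', rfl⟩ := dvd_iff_isRoot.mpr hr
    have hd' : d' ≠ 0 := right_ne_zero_of_mul hd
    obtain ⟨w', rfl⟩ := exists_linear_factor_cancel h2 hℓ r h
    refine ih hd' (w := w') ?_ ?_
    · rw [mul_pow, map_mul, mul_pow, mul_left_comm] at h
      exact mul_left_cancel₀ (pow_ne_zero _ (hinj (X_sub_C_ne_zero r))) h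
    · rw [natDegree_mul (X_sub_C_ne_zero r) hd', natDegree_X_sub_C] at hn
      omega

/-- A function with a pole of order `ℓ` at infinity is not an `ℓ`-th power. -/
theorem MonicAt.not_isPow [V.IsElliptic] [IsAlgClosed F] (h2 : (2 : F) ≠ 0) {ℓ : ℕ}
    (hℓ : ℓ ≠ 0) {g : V.CoordinateRing} (hg : MonicAt g ℓ) (ρ : V.FunctionField) :
    ρ ^ ℓ ≠ algebraMap V.CoordinateRing V.FunctionField g := by
  intro h
  obtain ⟨u, v, hv, rfl⟩ := IsFractionRing.div_surjective (A := V.CoordinateRing) ρ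
  have hv0 : v ≠ 0 := nonZeroDivisors.ne_zero hv
  have hinj := IsFractionRing.injective V.CoordinateRing V.FunctionField
  have huv : u ^ ℓ = g * v ^ ℓ := by
    apply hinj
    rw [div_pow, div_eq_iff (pow_ne_zero _ ((map_ne_zero_iff _ hinj).mpr hv0))] at h
    rw [map_mul, map_pow, map_pow, h]
  -- The conjugate `v'` of `v` makes the denominator a polynomial in `X`, to be cancelled one linear
  -- factor at a time.
  obtain ⟨v', hv'⟩ : ∃ v', algebraMap F[X] V.CoordinateRing (Algebra.norm F[X] v) = v * v' := by
    obtain ⟨p, q, rfl⟩ := CoordinateRing.exists_smul_basis_eq v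
    refine ⟨CoordinateRing.mk V (C p + C q * (-(Y : F[X][Y]) - C (C V.a₁ * X + C V.a₃))), ?_⟩
    rw [CoordinateRing.smul, CoordinateRing.smul, mul_one, ← map_mul, ← map_add, ← map_mul,
      ← CoordinateRing.coe_norm_smul_basis, CoordinateRing.smul, CoordinateRing.smul, mul_one,
      ← map_mul, ← map_add]
    rfl
  have := Module.Finite.of_basis (CoordinateRing.basis V)
  have := Module.Free.of_basis (CoordinateRing.basis V)
  obtain ⟨w, hw⟩ := exists_pow_eq_of_pow_eq_mul h2 hℓ (Algebra.norm_ne_zero_iff.mpr hv0)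
    (w := u * v') (g := g) (by rw [mul_pow, huv, hv']; ring)
  have hd := congr_arg (fun f => (Algebra.norm F[X] f).natDegree) hw
  simp only [map_pow, natDegree_pow, hg.natDegree_norm] at hd
  -- An `ℓ`-th root of `g` would have a simple pole at infinity and no other.
  exact CoordinateRing.natDegree_norm_ne_one w
    (Nat.eq_of_mul_eq_mul_left (Nat.pos_of_ne_zero hℓ) (by rw [hd, mul_one]))

end Roots

/-! ### Descent of fixed elements -/

lemma mem_range_of_fixed {M Ω : Type*} [Field M] [Field Ω] [Algebra M Ω] [IsAlgClosure M Ω] {x : Ω}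
    {p : M[X]} (hp : p.Separable) (hx : aeval x p = 0) (hfix : ∀ σ : Ω ≃ₐ[M] Ω, σ x = x) :
    x ∈ (algebraMap M Ω).range := by
  have hsep : IsSeparable M x := hp.of_dvd (minpoly.dvd M x hx)
  have := IsAlgClosure.isAlgClosed M (K := Ω)
  by_contra hn
  obtain ⟨y, hy, hxy⟩ := (notMem_iff_exists_ne_and_isConjRoot hsep
    (IsAlgClosed.splits _)).mp (by rwa [Algebra.mem_bot])
  obtain ⟨σ, rfl⟩ := isConjRoot_iff_exists_algEquiv.mp hxy.symm
  exact hy (hfix σ).symm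

end

section

/-! ### The generic point -/

section Generic

variable {F : Type*} [Field F] {V : WeierstrassCurve.Affine F}

/-- The inclusion of the base field in the function field. -/
def toFunctionField (V : WeierstrassCurve.Affine F) : F →+* V.FunctionField :=
  (algebraMap V.CoordinateRing V.FunctionField).comp (algebraMap F V.CoordinateRing)

lemma equation_generic (V : WeierstrassCurve.Affine F) :
    (V.map (toFunctionField V)).toAffine.Equation
      (algebraMap V.CoordinateRing V.FunctionField (CoordinateRing.mk V (C X)))
      (algebraMap V.CoordinateRing V.FunctionField (CoordinateRing.mk V Y)) := by
  have h : CoordinateRing.mk V V.polynomial = 0 := AdjoinRoot.mk_self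
  have h' := congr_arg (algebraMap V.CoordinateRing V.FunctionField) h
  rw [equation_iff]
  change _ ^ 2 + algebraMap V.CoordinateRing V.FunctionField (CoordinateRing.mk V (C (C V.a₁))) * _
      * _ + algebraMap V.CoordinateRing V.FunctionField (CoordinateRing.mk V (C (C V.a₃))) * _ =
    _ ^ 3 + algebraMap V.CoordinateRing V.FunctionField (CoordinateRing.mk V (C (C V.a₂))) * _ ^ 2 +
      algebraMap V.CoordinateRing V.FunctionField (CoordinateRing.mk V (C (C V.a₄))) * _ +
      algebraMap V.CoordinateRing V.FunctionField (CoordinateRing.mk V (C (C V.a₆)))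
  simp only [WeierstrassCurve.Affine.polynomial, map_add, map_sub, map_mul,
    map_pow, map_zero] at h'
  linear_combination h'

/-- The generic point of `V`, over its function field. -/
def genericPoint (V : WeierstrassCurve.Affine F) [V.IsElliptic] :
    (V.map (toFunctionField V)).toAffine.Point :=
  .mk (equation_generic V)

lemma genericPoint_ne_zero [V.IsElliptic] : genericPoint V ≠ 0 := Point.some_ne_zero _

/-- Evaluation at the generic point returns the function, so facts about values at points become
facts about elements of the function field. -/
lemma val_genericPoint [V.IsElliptic] (g : V.CoordinateRing) :
    val (genericPoint V) (mapFun (toFunctionField V) rfl g) =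
      algebraMap V.CoordinateRing V.FunctionField g := by
  have hX : ∀ p : F[X], (p.map (toFunctionField V)).eval (xCoord (genericPoint V)) =
      algebraMap V.CoordinateRing V.FunctionField (algebraMap F[X] V.CoordinateRing p) := by
    intro p
    have : eval₂RingHom (toFunctionField V) (xCoord (genericPoint V)) =
        (algebraMap V.CoordinateRing V.FunctionField).comp (algebraMap F[X] V.CoordinateRing) := by
      refine Polynomial.ringHom_ext (fun c => ?_) ?_
      · rw [coe_eval₂RingHom, eval₂_C]; rfl
      · rw [coe_eval₂RingHom, eval₂_X]; rfl
    rw [eval_map, ← coe_eval₂RingHom, this]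
    rfl
  obtain ⟨p, q, rfl⟩ := CoordinateRing.exists_smul_basis_eq g
  rw [mapFun_smul_basis, val_smul_basis genericPoint_ne_zero, hX, hX, Algebra.smul_def,
    Algebra.smul_def, mul_one, map_add, map_mul]
  rfl

end Generic

/-! ### The pairing is nondegenerate -/

section Nondegenerate

variable {F : Type*} [Field F] {V : WeierstrassCurve.Affine F} [V.IsElliptic] {ℓ : ℕ}

lemma translates_combination [Infinite V.Point] (hℓ : ℓ.Prime)
    (hsurj : ∀ Q : V.Point, ∃ P, ℓ • P = Q) {W T : V.Point} (hW' : ℓ • W = 0) (hT' : ℓ • T = 0)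
    (hT : T ∉ AddSubgroup.zmultiples W) (hW : W ≠ 0) (a b : ℕ) :
    Translates ℓ W (a • W + b • T) (pairing ℓ T W ^ b) := by
  have hT0 : T ≠ 0 := by rintro rfl; exact hT (zero_mem _)
  have hTW : T ≠ W := by rintro rfl; exact hT (AddSubgroup.mem_zmultiples _)
  have h1 := (translates_self hℓ hsurj hW' hT' hT hW).nsmul hW' a
  have h2 := (translates_pairing hT0 hT' hW hW' hTW).nsmul hT' b
  have h := h1.add (by rw [smul_comm, hW', smul_zero]) h2
  rwa [one_pow, one_mul] at h

omit [V.IsElliptic] in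
lemma mapPoint_notMem_zmultiples {K : Type*} [Field K] {V' : WeierstrassCurve.Affine K}
    (f : F →+* K) (h : V.map f = V') {W T : V.Point} (hT : T ∉ AddSubgroup.zmultiples W) :
    mapPoint f h T ∉ AddSubgroup.zmultiples (mapPoint f h W) := by
  rintro ⟨n, hn⟩
  refine hT ⟨n, mapPoint_injective f h ?_⟩
  rw [← hn]
  exact map_zsmul _ _ _

lemma genericPoint_ne_mapPoint (hℓ : ℓ ≠ 0) {W : V.Point} (hW : W ≠ 0) (hW' : ℓ • W = 0) :
    genericPoint V ≠ mapPoint (toFunctionField V) rfl W := by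
  intro h
  have h1 := val_genericPoint (torsFun ℓ W)
  rw [h, val_mapFun, ((isFun_torsFun hW hW').val_eq_zero_iff hW).mpr
    ⟨0, Nat.pos_of_ne_zero hℓ, rfl⟩, map_zero] at h1
  exact (isFun_torsFun hW hW').monicAt.ne_zero
    ((map_eq_zero_iff _ (IsFractionRing.injective _ _)).mp h1.symm)

end Nondegenerate

universe u

/-- Take `P` over the closure of the function field with ℓP = -η, where η is the generic point; then
κ_W(P)^ℓ is the function h_W. Galois conjugation moves `P` by torsion, which leaves κ_W(P) unchanged
if the pairing is 1. So κ_W(P) lies in the function field and h_W is an `ℓ`-th power there, against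
`MonicAt.not_isPow`. -/
theorem pairing_ne_one {F : Type u} [Field F] [IsAlgClosed F] {V : WeierstrassCurve.Affine F}
    [V.IsElliptic] (h2 : (2 : F) ≠ 0) {ℓ : ℕ} (hℓ : ℓ.Prime) (hℓF : (ℓ : F) ≠ 0) {W T : V.Point}
    (hW' : ℓ • W = 0) (hT' : ℓ • T = 0) (hW : W ≠ 0) (hT : T ∉ AddSubgroup.zmultiples W)
    (hgen : ∀ R : V.Point, ℓ • R = 0 → ∃ a b : ℕ, R = a • W + b • T) : pairing ℓ T W ≠ 1 := by
  intro hpair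
  have hT0 : T ≠ 0 := by rintro rfl; exact hT (zero_mem _)
  set f := toFunctionField V with hf
  set g := algebraMap V.FunctionField (AlgebraicClosure V.FunctionField) with hg
  set e := g.comp f with he
  set V₁ := (V.map f).toAffine with hV₁
  set V₂ := (V.map e).toAffine with hV₂
  have h₁₂ : V₁.map g = V₂ := WeierstrassCurve.map_map ..
  have : V₁.IsElliptic := inferInstanceAs (V.map f).IsElliptic
  have : V₂.IsElliptic := inferInstanceAs (V.map e).IsElliptic
  have hsurj := exists_nsmul_eq (E := V₂) hℓ.ne_zero
  set η := mapPoint g h₁₂ (genericPoint V) with hη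
  set W₂ := mapPoint e hV₂ W with hW₂
  set T₂ := mapPoint e hV₂ T with hT₂
  have hW₂0 : W₂ ≠ 0 := mapPoint_ne_zero e hV₂ hW
  have hW₂' : ℓ • W₂ = 0 := by rw [hW₂, ← map_nsmul, hW', map_zero]
  have hT₂' : ℓ • T₂ = 0 := by rw [hT₂, ← map_nsmul, hT', map_zero]
  have hηW : η ≠ W₂ := by
    rw [hη, hW₂, ← mapPoint_mapPoint f g e rfl rfl h₁₂ hV₂]
    exact (mapPoint_injective g h₁₂).ne (genericPoint_ne_mapPoint hℓ.ne_zero hW hW')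
  obtain ⟨P, hP⟩ := hsurj (-η)
  have hP0 : ℓ • P ≠ 0 := hP ▸ neg_ne_zero.mpr (mapPoint_ne_zero g h₁₂ genericPoint_ne_zero)
  have hPW : ℓ • P ≠ -W₂ := by rw [hP]; exact neg_injective.ne hηW
  have hpow : kummer ℓ W₂ P ^ ℓ =
      g (algebraMap V.CoordinateRing V.FunctionField (torsFun ℓ W)) := by
    rw [kummer_pow hW₂0 hW₂' hP0, hP, neg_neg, hW₂, ← mapFun_torsFun e hV₂ hW hW',
      ← mapFun_mapFun f g e rfl rfl h₁₂ hV₂, hη, val_mapFun, val_genericPoint]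
  have hfix : ∀ σ : AlgebraicClosure V.FunctionField ≃ₐ[V.FunctionField]
      AlgebraicClosure V.FunctionField, σ (kummer ℓ W₂ P) = kummer ℓ W₂ P := by
    intro σ
    set s : AlgebraicClosure V.FunctionField →+* AlgebraicClosure V.FunctionField := RingHomClass.toRingHom σ with hs
    have hsg : s.comp g = g := RingHom.ext fun x => σ.commutes x
    have hse : s.comp e = e := by rw [he, ← RingHom.comp_assoc, hsg]
    have hV : V₂.map s = V₂ := by
      rw [hV₂]; exact (WeierstrassCurve.map_map ..).trans (by rw [hse])
    have hsη : mapPoint s hV η = η := mapPoint_mapPoint g s g hsg h₁₂ hV h₁₂ _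
    have hsW : mapPoint s hV W₂ = W₂ := mapPoint_mapPoint e s e hse hV₂ hV hV₂ _
    -- The torsion is already defined over the algebraically closed `F`, so the displacement of `P`
    -- is a combination of `W` and `T`.
    obtain ⟨R, hR', hR⟩ := exists_mapPoint_eq_of_torsion hℓ.ne_zero e hV₂
      (T := mapPoint s hV P - P)
      (by rw [smul_sub, ← map_nsmul, hP, map_neg, hsη, sub_self])
    obtain ⟨a, b, rfl⟩ := hgen R hR'
    rw [map_add, map_nsmul, map_nsmul] at hR
    have htr := translates_combination hℓ hsurj hW₂' hT₂' (mapPoint_notMem_zmultiples e hV₂ hT)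
      hW₂0 a b P hP0 hPW
    rw [mapPoint_pairing e hV₂ hT0 hT' hW hW', hpair, map_one, one_pow, one_mul, hR,
      add_sub_cancel] at htr
    have hk := kummer_mapPoint s hV hW₂0 hW₂' hP0
    rw [hsW, htr] at hk
    exact hk.symm
  have ha : algebraMap V.CoordinateRing V.FunctionField (torsFun ℓ W) ≠ 0 :=
    (map_ne_zero_iff _ (IsFractionRing.injective _ _)).mpr (isFun_torsFun hW hW').monicAt.ne_zero
  have hℓM : (ℓ : V.FunctionField) ≠ 0 := by
    rw [← map_natCast f]
    exact (map_ne_zero f).mpr hℓF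
  obtain ⟨ρ, hρ⟩ := mem_range_of_fixed (separable_X_pow_sub_C _ hℓM ha)
    (by rw [map_sub, map_pow, aeval_X, aeval_C, hpow, sub_self]) hfix
  refine (isFun_torsFun hW hW').monicAt.not_isPow h2 hℓ.ne_zero ρ (g.injective ?_)
  rw [← hpow, map_pow, hρ]

end

section

/-! ### Functions with prescribed divisor -/

section Divisor

variable {k : Type*} [Field k] {E : WeierstrassCurve k}

instance : IsNoetherianRing E.toAffine.CoordinateRing :=
  inferInstanceAs (IsNoetherianRing (k[X][Y] ⧸ Ideal.span {E.toAffine.polynomial}))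

lemma eq_parts (f : E.toAffine.CoordinateRing) :
    f = xPart E f • (1 : E.toAffine.CoordinateRing) +
      yPart E f • CoordinateRing.mk E.toAffine Y := by
  have := (CoordinateRing.basis E.toAffine).sum_repr f
  rw [Fin.sum_univ_two, CoordinateRing.basis_zero, CoordinateRing.basis_one] at this
  exact this.symm

lemma poleOrder_eq (f : E.toAffine.CoordinateRing) :
    poleOrder E f = (Algebra.norm k[X] f).natDegree := by
  conv_rhs => rw [eq_parts f]
  rw [natDegree, CoordinateRing.degree_norm_smul_basis]
  rfl

/-- By Krull's intersection theorem. Without boundedness the `sSup` in `ord` would take its default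
value 0. -/
lemma bddAbove_of_ne_zero (M : MaximalSpectrum E.toAffine.CoordinateRing)
    {f : E.toAffine.CoordinateRing} (hf : f ≠ 0) : BddAbove {n : ℕ | f ∈ M.asIdeal ^ n} := by
  by_contra h
  apply hf
  have hM := Ideal.iInf_pow_eq_bot_of_isDomain M.asIdeal M.isMaximal.ne_top
  rw [← Ideal.mem_bot, ← hM, Ideal.mem_iInf]
  intro n
  rw [not_bddAbove_iff] at h
  obtain ⟨m, hm, hnm⟩ := h n
  exact Ideal.pow_le_pow_right hnm.le hm

lemma mem_pow_of_ord (M : MaximalSpectrum E.toAffine.CoordinateRing)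
    {f : E.toAffine.CoordinateRing} (hf : f ≠ 0) {n : ℕ} (h : ord E f (some M) = n) :
    f ∈ M.asIdeal ^ n ∧ f ∉ M.asIdeal ^ (n + 1) := by
  have hb := bddAbove_of_ne_zero M hf
  have hs : sSup {n : ℕ | f ∈ M.asIdeal ^ n} = n := by
    simp only [ord] at h
    exact_mod_cast h
  constructor
  · have := Nat.sSup_mem ⟨0, by simp⟩ hb
    rwa [hs] at this
  · intro h'
    have : n + 1 ≤ _ := le_csSup hb h'
    rw [hs] at this
    omega

lemma exists_eq_span_mul {A : Type*} [CommRing A] {I : Ideal A} {a : A}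
    (h : I ≤ Ideal.span {a}) : ∃ J : Ideal A, I = Ideal.span {a} * J := by
  refine ⟨Submodule.comap (LinearMap.mulLeft A a) I, le_antisymm (fun x hx => ?_) ?_⟩
  · obtain ⟨b, rfl⟩ := Ideal.mem_span_singleton.mp (h hx)
    exact Ideal.mul_mem_mul (Ideal.mem_span_singleton_self a) hx
  · rw [Ideal.span_singleton_mul_le_iff]
    exact fun z hz => hz

/-- As `I` is invertible, (f) = Iⁿ J for some `J`. A maximal ideal containing `J` contains `f`,
hence is `I`, which would put `f` into the next power; so `J` is the unit ideal. -/
lemma span_eq_pow {A : Type*} [CommRing A] [IsDomain A] {I I' : Ideal A} {v : A} (hv : v ≠ 0)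
    (hI : I' * I = Ideal.span {v}) {n : ℕ} {f : A} (h1 : f ∈ I ^ n) (h2 : f ∉ I ^ (n + 1))
    (h3 : ∀ M : Ideal A, M.IsMaximal → f ∈ M → M = I) : Ideal.span {f} = I ^ n := by
  have hv' : v ^ n ≠ 0 := pow_ne_zero _ hv
  have hmul : I' ^ n * I ^ n = Ideal.span {v ^ n} := by
    rw [← mul_pow, hI, Ideal.span_singleton_pow]
  obtain ⟨J, hJ⟩ := exists_eq_span_mul (I := I' ^ n * Ideal.span {f}) (a := v ^ n) (by
      rw [← hmul]
      exact Ideal.mul_mono_right ((Ideal.span_singleton_le_iff_mem _).mpr h1))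
  have hfJ : Ideal.span {f} = I ^ n * J := by
    rw [← Ideal.span_singleton_mul_right_inj hv', ← hmul]
    calc _ = I ^ n * (I' ^ n * Ideal.span {f}) := by ring
      _ = _ := by rw [hJ, hmul]; ring
  have hf : f ∈ I ^ n * J := hfJ ▸ Ideal.mem_span_singleton_self f
  have hJtop : J = ⊤ := by
    by_contra hJ'
    obtain ⟨M, hM, hJM⟩ := Ideal.exists_le_maximal J hJ'
    have hfJ' : f ∈ J := (Ideal.mul_le_right : I ^ n * J ≤ J) hf
    have hMI : J ≤ I := (h3 M hM (hJM hfJ')) ▸ hJM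
    rw [pow_succ] at h2
    exact h2 ((Ideal.mul_mono_right hMI : I ^ n * J ≤ I ^ n * I) hf)
  rw [hfJ, hJtop, Ideal.mul_top]

variable {ℓ : ℕ} {W : E.toAffine.Point} {h : E.toAffine.CoordinateRing}

/-- For `W = 0` the prescribed divisor is zero, so `h` has no pole and is constant; the
normalization demands a nonzero coefficient of a nonconstant term. -/
lemma IsMillerFunction.ne_zero (hh : IsMillerFunction E ℓ W h) : W ≠ 0 := by
  rintro rfl
  have h0 := hh.hasDivisor.2 none
  rw [sub_self] at h0
  simp only [ord, Finsupp.coe_zero, Pi.zero_apply, neg_eq_zero, Nat.cast_eq_zero,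
    poleOrder_eq] at h0
  rw [eq_parts h] at h0
  by_cases hq : yPart E h = 0
  · rw [hq, natDegree_norm_smul_basis_zero] at h0
    have hn := hh.normalized
    split_ifs at hn
    · rw [coeff_eq_zero_of_natDegree_lt (by omega)] at hn
      exact zero_ne_one hn
    · rw [hq, coeff_zero] at hn
      exact zero_ne_one hn
  · rw [natDegree_norm_smul_basis _ _ hq] at h0
    omega

lemma IsMillerFunction.closedPoint_eq (hh : IsMillerFunction E ℓ W h) :
    closedPoint E W = some ⟨pointIdeal W, isMaximal_pointIdeal hh.ne_zero⟩ := by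
  have := hh.ne_zero
  rcases W with _ | ⟨x, y, hxy⟩
  · exact absurd rfl this
  · rfl

lemma IsMillerFunction.monicAt (hh : IsMillerFunction E ℓ W h) (hℓ : ℓ.Prime) : MonicAt h ℓ := by
  have h0 := hh.hasDivisor.2 none
  rw [hh.closedPoint_eq, Finsupp.sub_apply, Finsupp.single_eq_of_ne (by simp),
    show closedPoint E 0 = none from rfl, Finsupp.single_eq_same] at h0
  have h1 : (Algebra.norm k[X] h).natDegree = ℓ := by
    rw [← poleOrder_eq]
    simp only [ord] at h0
    omega
  have hn := hh.normalized
  have hparts := eq_parts h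
  rw [hparts] at h1
  by_cases hℓ2 : ℓ = 2
  · subst hℓ2
    rw [if_pos rfl] at hn
    have hq : yPart E h = 0 := by
      by_contra hq
      rw [natDegree_norm_smul_basis _ _ hq] at h1
      omega
    rw [hq, natDegree_norm_smul_basis_zero] at h1
    have hd : (xPart E h).natDegree = 1 := by omega
    refine ⟨1, _, _, hparts, Or.inl ⟨rfl, ?_, hd, Or.inl hq⟩⟩
    rw [Monic, leadingCoeff, hd, hn]
  · rw [if_neg hℓ2] at hn
    have hodd := hℓ.odd_of_ne_two hℓ2
    have h3 := hℓ.two_le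
    obtain ⟨m, hm⟩ : ∃ m, ℓ = 2 * m + 3 := by
      obtain ⟨j, hj⟩ := hodd
      exact ⟨j - 1, by omega⟩
    rw [hm, show (2 * m + 3 - 3) / 2 = m by omega] at hn
    have hq : yPart E h ≠ 0 := by
      intro hq
      rw [hq, coeff_zero] at hn
      exact zero_ne_one hn
    rw [natDegree_norm_smul_basis _ _ hq] at h1
    have hle : m ≤ (yPart E h).natDegree := le_natDegree_of_ne_zero (by rw [hn]; exact one_ne_zero)
    have hd : (yPart E h).natDegree = m := by omega
    refine ⟨m, _, _, hparts, Or.inr ⟨hm, ?_, hd, by omega⟩⟩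
    rw [Monic, leadingCoeff, hd, hn]

theorem IsMillerFunction.isFun (hh : IsMillerFunction E ℓ W h) (hℓ : ℓ.Prime)
    (hW : ℓ • W = 0) : IsFun h (fun _ => W) ℓ where
  ne_zero _ _ := hh.ne_zero
  sum_eq := by simpa using hW
  monicAt := hh.monicAt hℓ
  span_eq := by
    have hord : ∀ M : MaximalSpectrum E.toAffine.CoordinateRing, ord E h (some M) =
        ((if M.asIdeal = pointIdeal W then ℓ else 0 : ℕ) : ℤ) := by
      intro M
      rw [hh.hasDivisor.2, hh.closedPoint_eq, Finsupp.sub_apply,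
        show closedPoint E 0 = none from rfl, Finsupp.single_eq_of_ne (by simp) (a := none), sub_zero]
      split_ifs with hM
      · rw [show M = ⟨pointIdeal W, isMaximal_pointIdeal hh.ne_zero⟩ from
          MaximalSpectrum.ext hM, Finsupp.single_eq_same]
      · rw [Finsupp.single_eq_of_ne]
        · rfl
        · rintro h
          exact hM (congr_arg MaximalSpectrum.asIdeal (Option.some.inj h))
    rw [Finset.prod_const, Finset.card_range]
    have hWm := mem_pow_of_ord ⟨pointIdeal W, isMaximal_pointIdeal hh.ne_zero⟩ hh.hasDivisor.1
      ((hord _).trans (by rw [if_pos rfl]))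
    refine span_eq_pow (vert_ne_zero W) (pointIdeal_neg_mul hh.ne_zero) hWm.1 hWm.2 fun M hM hhM => ?_
    by_contra hne
    have := (mem_pow_of_ord ⟨M, hM⟩ hh.hasDivisor.1 ((hord _).trans (by rw [if_neg hne]))).2
    rw [zero_add, pow_one] at this
    exact this hhM

lemma value_eq_val (f : E.toAffine.CoordinateRing) (P : E.toAffine.Point) (hP : P ≠ 0) :
    value E f P hP = val P f := by
  rcases P with _ | _
  · exact absurd rfl hP
  · rfl

lemma extendPoint_eq (K : Type*) [Field K] [Algebra k K] (P : E.toAffine.Point) :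
    extendPoint E K P = mapPoint (algebraMap k K) rfl P := by
  rcases P with _ | _ <;> rfl

end Divisor

end

section

/-! ### Torsion subgroups with two generators -/

lemma exists_zsmul_eq_nsmul {G : Type*} [AddCommGroup G] {ℓ : ℕ} (hℓ : ℓ ≠ 0) {x : G}
    (hx : ℓ • x = 0) (m : ℤ) : ∃ a < ℓ, m • x = a • x := by
  have h0 : (0 : ℤ) < ℓ := by exact_mod_cast Nat.pos_of_ne_zero hℓ
  obtain ⟨a, ha⟩ := Int.eq_ofNat_of_zero_le (Int.emod_nonneg m h0.ne')
  refine ⟨a, by exact_mod_cast ha ▸ Int.emod_lt_of_pos m h0, ?_⟩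
  conv_lhs => rw [← Int.mul_ediv_add_emod m ℓ, ha]
  rw [add_zsmul, mul_comm, mul_zsmul, natCast_zsmul, natCast_zsmul, hx, smul_zero, zero_add]

section Points

universe u

variable {F : Type u} [Field F] {V : WeierstrassCurve.Affine F} [V.IsElliptic] {ℓ : ℕ}

/-- Otherwise the torsion would lie in a cyclic group with at most `ℓ` elements, while it has at
least `ℓ ^ 2`. -/
lemma notMem_zmultiples_of_generates [IsAlgClosed F] (hℓ : ℓ.Prime) (hℓF : (ℓ : F) ≠ 0)
    {W T : V.Point} (hW : ℓ • W = 0)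
    (hgen : ∀ R : V.Point, ℓ • R = 0 → ∃ a b : ℕ, R = a • W + b • T) :
    T ∉ AddSubgroup.zmultiples W := by
  intro hT
  obtain ⟨S, hS, hS'⟩ := exists_torsion_finset (E := V) hℓF
  have hsub : S ⊆ (Finset.range ℓ).image fun i => i • W := by
    intro R hR
    obtain ⟨a, b, rfl⟩ := hgen R (hS' R hR)
    obtain ⟨m, hm⟩ := AddSubgroup.add_mem _
      (AddSubgroup.nsmul_mem _ (AddSubgroup.mem_zmultiples W) a) (AddSubgroup.nsmul_mem _ hT b)
    obtain ⟨c, hc, hc'⟩ := exists_zsmul_eq_nsmul hℓ.ne_zero hW m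
    exact Finset.mem_image.mpr ⟨c, Finset.mem_range.mpr hc, hc'.symm.trans hm⟩
  have := (Finset.card_le_card hsub).trans Finset.card_image_le
  rw [hS, Finset.card_range] at this
  nlinarith [hℓ.two_le]

lemma pairing_pow [Infinite V.Point] (hℓ : ℓ ≠ 0) (hsurj : ∀ Q : V.Point, ∃ P, ℓ • P = Q)
    {W T : V.Point} (hW' : ℓ • W = 0) (hT' : ℓ • T = 0) (hW : W ≠ 0) (hT : T ≠ 0) (hTW : T ≠ W) :
    pairing ℓ T W ^ ℓ = 1 := by
  have h := (translates_pairing hT hT' hW hW' hTW).nsmul hT' ℓ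
  rw [hT'] at h
  exact h.unique' hsurj hℓ hW hW' (translates_zero W)

end Points

/-! ### Rational points -/

/-- The minimal polynomial has degree at most 4, which is prime to the characteristic, so its
derivative is nonzero and it is separable. -/
lemma mem_range_of_fixed_of_natDegree_le {M Ω : Type*} [Field M] [Field Ω] [Algebra M Ω]
    [IsAlgClosure M Ω] {x : Ω} (h2 : (2 : M) ≠ 0) (h3 : (3 : M) ≠ 0) {p : M[X]} (hp : p ≠ 0)
    (hd : p.natDegree ≤ 4) (hx : aeval x p = 0) (hfix : ∀ σ : Ω ≃ₐ[M] Ω, σ x = x) :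
    x ∈ (algebraMap M Ω).range := by
  have hint : IsIntegral M x := (IsAlgClosure.isAlgebraic.isAlgebraic x).isIntegral
  refine mem_range_of_fixed (p := minpoly M x) ?_ (minpoly.aeval M x) hfix
  rw [separable_iff_derivative_ne_zero (minpoly.irreducible hint)]
  intro h0
  have hle : (minpoly M x).natDegree ≤ 4 :=
    (natDegree_le_of_dvd (minpoly.dvd M x hx) hp).trans hd
  have hpos := minpoly.natDegree_pos hint
  have hmonic := minpoly.monic hint
  obtain ⟨n, hn⟩ := Nat.exists_eq_succ_of_ne_zero hpos.ne'
  have hc := congr_arg (coeff · n) h0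
  simp only [coeff_derivative, coeff_zero] at hc
  have h1 : (minpoly M x).coeff (n + 1) = 1 := by
    rw [← Nat.succ_eq_add_one, ← hn]; exact hmonic.coeff_natDegree
  rw [h1, one_mul] at hc
  have hn3 : n ≤ 3 := by omega
  have h4 : (4 : M) ≠ 0 := by
    rw [show (4 : M) = 2 * 2 by norm_num]; exact mul_ne_zero h2 h2
  interval_cases n <;> norm_num at hc
  · exact h2 hc
  · exact h3 hc
  · exact h4 hc

section Descent

universe u

variable {k : Type u} [Field k] {E : WeierstrassCurve.Affine k}

lemma exists_rational_of_fixed (h2 : (2 : k) ≠ 0) (h3 : (3 : k) ≠ 0)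
    {P : (E.map (algebraMap k (AlgebraicClosure k))).toAffine.Point}
    (hx : xCoord P ∈ (algebraMap k (AlgebraicClosure k)).range)
    (hy : ∀ σ : AlgebraicClosure k ≃ₐ[k] AlgebraicClosure k, σ (yCoord P) = yCoord P) :
    ∃ P₀ : E.Point, mapPoint (algebraMap k (AlgebraicClosure k)) rfl P₀ = P := by
  rcases P with _ | ⟨x, y, h⟩
  · exact ⟨0, map_zero _⟩
  obtain ⟨x₀, rfl⟩ : x ∈ (algebraMap k (AlgebraicClosure k)).range := hx
  have hdeg : (X ^ 2 + C (E.a₁ * x₀ + E.a₃) * X -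
      C (x₀ ^ 3 + E.a₂ * x₀ ^ 2 + E.a₄ * x₀ + E.a₆)).natDegree = 2 := by compute_degree!
  obtain ⟨y₀, rfl⟩ : y ∈ (algebraMap k (AlgebraicClosure k)).range := by
    refine mem_range_of_fixed_of_natDegree_le h2 h3 (p := X ^ 2 + C (E.a₁ * x₀ + E.a₃) * X -
      C (x₀ ^ 3 + E.a₂ * x₀ ^ 2 + E.a₄ * x₀ + E.a₆)) ?_ (by omega) ?_ hy
    · intro h0
      rw [h0, natDegree_zero] at hdeg
      omega
    · have e := (equation_iff' ..).mp h.1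
      simp only [map_sub, map_add, map_mul, map_pow, aeval_X, aeval_C]
      simp only [WeierstrassCurve.map_a₁, WeierstrassCurve.map_a₂, WeierstrassCurve.map_a₃,
        WeierstrassCurve.map_a₄, WeierstrassCurve.map_a₆] at e
      linear_combination e
  exact ⟨.some x₀ y₀ ((map_nonsingular _ (algebraMap k (AlgebraicClosure k)).injective ..).mp h),
    rfl⟩

/-- The equation for the abscissas of the `ℓ`-division points of `Q` is separable unless `Q` is a
two-torsion point. -/
lemma IsMulPair.separable_sub [E.IsElliptic] {ℓ : ℕ} {A B : k[X]} (h : IsMulPair E ℓ A B)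
    (hℓ : (ℓ : k) ≠ 0) {Q : E.Point} (hQ : 2 • Q ≠ 0) : (A - C (xCoord Q) * B).Separable := by
  set f := algebraMap k (AlgebraicClosure k) with hf
  set V := (E.map f).toAffine with hV
  have : V.IsElliptic := inferInstanceAs (E.map f).IsElliptic
  have hℓ0 : ℓ ≠ 0 := by rintro rfl; simp at hℓ
  obtain ⟨S, hS, hS'⟩ := exists_torsion_finset (E := V) (n := ℓ) (by
    rw [← map_natCast f]; exact (map_ne_zero f).mpr hℓ)
  obtain ⟨P, hP⟩ := exists_nsmul_eq (E := V) hℓ0 (mapPoint f hV Q)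
  have hQ2 : 2 • mapPoint f hV Q ≠ 0 := by
    rw [← map_nsmul]; exact mapPoint_ne_zero f hV hQ
  have hQ0 : mapPoint f hV Q ≠ 0 := by intro h0; rw [h0, smul_zero] at hQ2; exact hQ2 rfl
  have hPT : ∀ T ∈ S, ℓ • (P + T) = mapPoint f hV Q := fun T hT => by
    rw [smul_add, hS' T hT, add_zero, hP]
  have hPT0 : ∀ T ∈ S, P + T ≠ 0 := fun T hT h0 => hQ0 (by rw [← hPT T hT, h0, smul_zero])
  have hq := h.monic_sub (xCoord Q)
  set q := A - C (xCoord Q) * B with hqdef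
  have hroots : (S.image fun T => xCoord (P + T)) ⊆ (q.map f).roots.toFinset := by
    intro x hx
    obtain ⟨T, hT, rfl⟩ := Finset.mem_image.mp hx
    rw [Multiset.mem_toFinset, mem_roots (hq.1.map f).ne_zero, IsRoot, eval_map, hqdef, eval₂_sub,
      eval₂_mul, eval₂_C, h.eval_num_eq f hV (hPT0 T hT) (by rw [hPT T hT]; exact hQ0), hPT T hT,
      xCoord_mapPoint, sub_self]
  -- Two division points share an abscissa only if they are equal or opposite, and opposite ones
  -- would give Q = -Q. So the division points have `ℓ ^ 2` distinct abscissas.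
  have hinj : Set.InjOn (fun T => xCoord (P + T)) (S : Set V.Point) := by
    intro T hT T' hT' e
    rcases eq_or_eq_neg_of_xCoord (hPT0 T hT) (hPT0 T' hT') e with e | e
    · exact add_left_cancel e
    · exfalso
      have e' := congr_arg (ℓ • ·) e
      simp only [smul_neg] at e'
      rw [hPT T hT, hPT T' hT'] at e'
      exact hQ2 (by rw [two_nsmul]; nth_rewrite 1 [e']; exact neg_add_cancel _)
  have hcard := Finset.card_le_card hroots
  rw [Finset.card_image_of_injOn hinj, hS] at hcard
  have hle : (q.map f).roots.card ≤ ℓ ^ 2 := by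
    have := card_roots' (q.map f)
    rwa [natDegree_map, hq.2] at this
  rw [← separable_map f, ← nodup_roots_iff_of_splits (hq.1.map f).ne_zero (IsAlgClosed.splits _),
    ← Multiset.toFinset_card_eq_card_iff_nodup]
  exact le_antisymm (Multiset.toFinset_card_le _) (hle.trans hcard)

end Descent

end

section

/-! ### The criterion for divisibility -/

section Criterion

universe u

variable {k : Type u} [Field k] {E : WeierstrassCurve.Affine k} [E.IsElliptic] {ℓ : ℕ}

/-- Both κ and ω are `ℓ`-th roots of the same value, nonzero because `Q ≠ -W`; they differ by a
power of the root of unity `c`, which lies in `k`. -/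
lemma kummer_mem_range {K : Type*} [Field K] (f : k →+* K) {V : WeierstrassCurve.Affine K}
    [V.IsElliptic] (hV : E.map f = V) (hℓ : ℓ ≠ 0) {W Q : E.Point} (hW : W ≠ 0) (hW' : ℓ • W = 0)
    (hQ : Q ≠ 0) (hQW : Q ≠ -W) {P : V.Point} (hP : ℓ • P = mapPoint f hV Q) {ω c : k}
    (hω : ω ^ ℓ = val (-Q) (torsFun ℓ W)) (hc : IsPrimitiveRoot c ℓ) :
    kummer ℓ (mapPoint f hV W) P ∈ f.range := by
  have hω0 : ω ≠ 0 := by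
    rw [← pow_ne_zero_iff hℓ, hω]
    exact val_torsFun_ne_zero hW hW' fun h => hQW (by rw [← h, neg_neg])
  have hfω : f ω ≠ 0 := (map_ne_zero f).mpr hω0
  have hpow : kummer ℓ (mapPoint f hV W) P ^ ℓ = f ω ^ ℓ := by
    rw [kummer_pow (mapPoint_ne_zero f hV hW) (by rw [← map_nsmul, hW', map_zero])
      (by rw [hP]; exact mapPoint_ne_zero f hV hQ), hP, ← mapFun_torsFun f hV hW hW', ← map_neg,
      val_mapFun, ← hω, map_pow]
  have : NeZero ℓ := ⟨hℓ⟩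
  obtain ⟨i, -, hi⟩ := (hc.map_of_injective f.injective).eq_pow_of_pow_eq_one
    (ξ := kummer ℓ (mapPoint f hV W) P / f ω)
    (by rw [div_pow, hpow, div_self (pow_ne_zero _ hfω)])
  exact ⟨c ^ i * ω, by rw [map_mul, map_pow, hi, div_mul_cancel₀ _ hfω]⟩

theorem exists_nsmul_eq_of_isPow (h2 : (2 : k) ≠ 0) (h3 : (3 : k) ≠ 0) (hℓ : ℓ.Prime)
    (hℓk : (ℓ : k) ≠ 0) {W T : E.Point} (hW' : ℓ • W = 0) (hT' : ℓ • T = 0)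
    (hgen : ∀ R : (E.map (algebraMap k (AlgebraicClosure k))).toAffine.Point, ℓ • R = 0 →
      ∃ a b : ℕ, R = a • mapPoint (algebraMap k (AlgebraicClosure k)) rfl W +
        b • mapPoint (algebraMap k (AlgebraicClosure k)) rfl T)
    {Q : E.Point} (hQ : Q ≠ 0) (hQW : Q ≠ -W) (hQT : Q ≠ -T) {ω ω' : k}
    (hω : ω ^ ℓ = val (-Q) (torsFun ℓ W)) (hω' : ω' ^ ℓ = val (-Q) (torsFun ℓ T)) :
    ∃ P : E.Point, ℓ • P = Q := by
  set f := algebraMap k (AlgebraicClosure k) with hf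
  set V := (E.map f).toAffine with hV
  have : V.IsElliptic := inferInstanceAs (E.map f).IsElliptic
  have hℓ0 := hℓ.ne_zero
  have hsurj := exists_nsmul_eq (E := V) hℓ0
  set W₁ := mapPoint f hV W with hW₁
  set T₁ := mapPoint f hV T with hT₁
  have hW₁' : ℓ • W₁ = 0 := by rw [hW₁, ← map_nsmul, hW', map_zero]
  have hT₁' : ℓ • T₁ = 0 := by rw [hT₁, ← map_nsmul, hT', map_zero]
  have hℓV : (ℓ : AlgebraicClosure k) ≠ 0 := by
    rw [← map_natCast f]; exact (map_ne_zero f).mpr hℓk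
  have h2V : (2 : AlgebraicClosure k) ≠ 0 := by
    rw [← map_ofNat f]; exact (map_ne_zero f).mpr h2
  replace hgen : ∀ R : V.Point, ℓ • R = 0 → ∃ a b : ℕ, R = a • W₁ + b • T₁ := hgen
  have hgen' : ∀ R : V.Point, ℓ • R = 0 → ∃ a b : ℕ, R = a • T₁ + b • W₁ := fun R hR => by
    obtain ⟨a, b, h⟩ := hgen R hR
    exact ⟨b, a, by rw [h, add_comm]⟩
  have hTW := notMem_zmultiples_of_generates hℓ hℓV hW₁' hgen
  have hWT := notMem_zmultiples_of_generates hℓ hℓV hT₁' hgen'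
  have hT₁0 : T₁ ≠ 0 := by intro h; exact hTW (h ▸ zero_mem _)
  have hW₁0 : W₁ ≠ 0 := by intro h; exact hWT (h ▸ zero_mem _)
  have hT0 : T ≠ 0 := by rintro rfl; exact hT₁0 (map_zero _)
  have hW0 : W ≠ 0 := by rintro rfl; exact hW₁0 (map_zero _)
  have hne : T₁ ≠ W₁ := by intro h; exact hTW (h ▸ AddSubgroup.mem_zmultiples _)
  have hprim : IsPrimitiveRoot (pairing ℓ T₁ W₁) ℓ := by
    have := Fact.mk hℓ
    exact IsPrimitiveRoot.iff_orderOf.mpr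
      (orderOf_eq_prime (pairing_pow hℓ0 hsurj hW₁' hT₁' hW₁0 hT₁0 hne)
        (pairing_ne_one h2V hℓ hℓV hW₁' hT₁' hW₁0 hTW hgen))
  have hprim' : IsPrimitiveRoot (pairing ℓ W₁ T₁) ℓ := by
    rw [← inv_eq_of_mul_eq_one_right (pairing_mul_pairing hT₁0 hT₁' hW₁0 hW₁' hne)]
    exact hprim.inv
  -- The pairing is formed from rational functions at rational points, so the primitive root lies in
  -- `k`.
  have hc : IsPrimitiveRoot (pairing ℓ T W) ℓ := by
    refine IsPrimitiveRoot.of_map_of_injective (f := f) ?_ f.injective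
    rw [← mapPoint_pairing f hV hT0 hT' hW0 hW']
    exact hprim
  obtain ⟨P, hP⟩ := hsurj (mapPoint f hV Q)
  have hQ₁ := mapPoint_ne_zero f hV hQ
  have hP0 : ℓ • P ≠ 0 := hP ▸ hQ₁
  have hPW : ℓ • P ≠ -W₁ := by
    rw [hP, hW₁, ← map_neg]; exact (mapPoint_injective f hV).ne hQW
  have hPT : ℓ • P ≠ -T₁ := by
    rw [hP, hT₁, ← map_neg]; exact (mapPoint_injective f hV).ne hQT
  obtain ⟨κ, hκ⟩ := kummer_mem_range f hV hℓ0 hW0 hW' hQ hQW hP hω hc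
  obtain ⟨κ', hκ'⟩ := kummer_mem_range f hV hℓ0 hT0 hT' hQ hQT hP hω' hc
  have hfix : ∀ σ : AlgebraicClosure k ≃ₐ[k] AlgebraicClosure k,
      σ (xCoord P) = xCoord P ∧ σ (yCoord P) = yCoord P := by
    intro σ
    set s : AlgebraicClosure k →+* AlgebraicClosure k := RingHomClass.toRingHom σ with hs
    have hsf : s.comp f = f := RingHom.ext fun x => σ.commutes x
    have hsV : V.map s = V := (WeierstrassCurve.map_map ..).trans (by rw [hsf])
    have hsm : ∀ R : E.Point, mapPoint s hsV (mapPoint f hV R) = mapPoint f hV R := fun R =>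
      mapPoint_mapPoint f s f hsf hV hsV hV R
    have hT : ℓ • (mapPoint s hsV P - P) = 0 := by
      rw [nsmul_sub, ← map_nsmul, hP, hsm, sub_self]
    obtain ⟨a, b, hab⟩ := hgen _ hT
    have hsP : mapPoint s hsV P = P + (a • W₁ + b • T₁) := by rw [← hab, add_sub_cancel]
    have h1 := translates_combination hℓ hsurj hW₁' hT₁' hTW hW₁0 a b P hP0 hPW
    have h1' := translates_combination hℓ hsurj hT₁' hW₁' hWT hT₁0 b a P hP0 hPT
    have e1 := kummer_mapPoint s hsV hW₁0 hW₁' hP0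
    have e1' := kummer_mapPoint s hsV hT₁0 hT₁' hP0
    rw [hsm, hsP, h1, ← hκ] at e1
    rw [hsm, hsP, add_comm (a • W₁), h1', ← hκ'] at e1'
    have hsc : ∀ x : k, s (f x) = f x := fun x => σ.commutes x
    rw [hsc, hκ] at e1
    rw [hsc, hκ'] at e1'
    -- Each κ is rational, hence fixed by σ, yet σ multiplies it by the pairing to the power `b`,
    -- respectively `a`.
    have hb := (hprim.pow_eq_one_iff_dvd b).mp
      ((mul_eq_right₀ (kummer_ne_zero hℓ0 hW₁0 hW₁' hP0 hPW)).mp e1)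
    have ha := (hprim'.pow_eq_one_iff_dvd a).mp
      ((mul_eq_right₀ (kummer_ne_zero hℓ0 hT₁0 hT₁' hP0 hPT)).mp e1')
    obtain ⟨a, rfl⟩ := ha
    obtain ⟨b, rfl⟩ := hb
    rw [mul_comm, mul_nsmul', hW₁', smul_zero, mul_comm ℓ, mul_nsmul', hT₁', smul_zero, add_zero,
      add_zero] at hsP
    have hx := xCoord_mapPoint s hsV P
    have hy := yCoord_mapPoint s hsV P
    rw [hsP] at hx hy
    exact ⟨hx.symm, hy.symm⟩
  obtain ⟨A, B, hAB⟩ := exists_isMulPair E ℓ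
  have hP0' : P ≠ 0 := by rintro rfl; exact hP0 (smul_zero _)
  have hroot : aeval (xCoord P) (A - C (xCoord Q) * B) = 0 := by
    rw [aeval_def, eval₂_sub, eval₂_mul, eval₂_C, hAB.eval_num_eq f hV hP0' hP0, hP,
      xCoord_mapPoint, sub_self]
  have hq := hAB.monic_sub (xCoord Q)
  have main : xCoord P ∈ f.range → ∃ P : E.Point, ℓ • P = Q := fun hx => by
    obtain ⟨P₀, hP₀⟩ := exists_rational_of_fixed h2 h3 hx fun σ => (hfix σ).2
    refine ⟨P₀, mapPoint_injective f hV ?_⟩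
    rw [map_nsmul, hP₀, hP]
  -- It remains to see that the fixed abscissa is separable over `k`. For `ℓ = 2` its equation has
  -- degree 4; for odd `ℓ` the equation is separable unless `2 • Q = 0`, and then `Q = ℓ • Q` is
  -- itself the point sought.
  by_cases hℓ2 : ℓ = 2
  · exact main (mem_range_of_fixed_of_natDegree_le h2 h3 hq.1.ne_zero (by rw [hq.2, hℓ2]; rfl) hroot
      fun σ => (hfix σ).1)
  by_cases hQ2 : 2 • Q = 0
  · obtain ⟨m, rfl⟩ := hℓ.odd_of_ne_two hℓ2
    refine ⟨Q, ?_⟩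
    rw [add_nsmul, mul_comm, mul_nsmul', hQ2, smul_zero, zero_add, one_nsmul]
  · exact main (mem_range_of_fixed (hAB.separable_sub hℓk hQ2) hroot fun σ => (hfix σ).1)

end Criterion

lemma TorsionGeneratedBy.exists_eq {k : Type*} [Field k] {E : WeierstrassCurve k} {ℓ : ℕ}
    (hℓ : ℓ ≠ 0) {W₁ W₂ : E.toAffine.Point} (h : TorsionGeneratedBy E ℓ W₁ W₂) :
    ℓ • W₁ = 0 ∧ ℓ • W₂ = 0 ∧
    ∀ R : (E.map (algebraMap k (AlgebraicClosure k))).toAffine.Point, ℓ • R = 0 →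
      ∃ a b : ℕ, R = a • mapPoint (algebraMap k (AlgebraicClosure k)) rfl W₁ +
        b • mapPoint (algebraMap k (AlgebraicClosure k)) rfl W₂ := by
  set f := algebraMap k (AlgebraicClosure k) with hf
  set V : WeierstrassCurve.Affine (AlgebraicClosure k) := E.map f with hV
  have h' : ∀ R : V.Point, ℓ • R = 0 ↔ R ∈ AddSubgroup.closure
      {mapPoint f hV.symm W₁, mapPoint f hV.symm W₂} := fun R => by
    rw [← extendPoint_eq, ← extendPoint_eq]
    exact h R
  have h1 : ℓ • mapPoint f hV.symm W₁ = 0 :=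
    (h' _).mpr (AddSubgroup.subset_closure (Set.mem_insert _ _))
  have h2 : ℓ • mapPoint f hV.symm W₂ = 0 :=
    (h' _).mpr (AddSubgroup.subset_closure (Set.mem_insert_of_mem _ rfl))
  refine ⟨mapPoint_injective f hV.symm (by rw [map_nsmul, h1, map_zero]),
    mapPoint_injective f hV.symm (by rw [map_nsmul, h2, map_zero]), fun R hR => ?_⟩
  obtain ⟨m, n, rfl⟩ := AddSubgroup.mem_closure_pair.mp ((h' R).mp hR)
  obtain ⟨a, -, ha⟩ := exists_zsmul_eq_nsmul hℓ h1 m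
  obtain ⟨b, -, hb⟩ := exists_zsmul_eq_nsmul hℓ h2 n
  exact ⟨a, b, congr_arg₂ (· + ·) ha hb⟩

end

end

end EllipticDivision

/-! ### The theorem -/

open EllipticDivision in
theorem theorem4 {k : Type*} [Field k] [DecidableEq k]
    (hk2 : ringChar k ≠ 2) (hk3 : ringChar k ≠ 3)
    (E : WeierstrassCurve k) [E.IsElliptic]
    (ℓ : ℕ) (hℓ : ℓ.Prime) (hkℓ : ringChar k ≠ ℓ)
    (W₁ W₂ : E.toAffine.Point) (hW : TorsionGeneratedBy E ℓ W₁ W₂)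
    (h₁ h₂ : E.toAffine.CoordinateRing)
    (hh₁ : IsMillerFunction E ℓ W₁ h₁) (hh₂ : IsMillerFunction E ℓ W₂ h₂)
    (Q : E.toAffine.Point) (hQ : Q ≠ 0) :
    ((∃ P : E.toAffine.Point, ℓ • P = Q) →
      (∃ ω₁ : k, ω₁ ^ ℓ = value E h₁ (-Q) (neg_ne_zero.mpr hQ)) ∧
      (∃ ω₂ : k, ω₂ ^ ℓ = value E h₂ (-Q) (neg_ne_zero.mpr hQ))) ∧
    (Q ≠ -W₁ → Q ≠ -W₂ →
      ((∃ P : E.toAffine.Point, ℓ • P = Q) ↔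
        (∃ ω₁ : k, ω₁ ^ ℓ = value E h₁ (-Q) (neg_ne_zero.mpr hQ)) ∧
        (∃ ω₂ : k, ω₂ ^ ℓ = value E h₂ (-Q) (neg_ne_zero.mpr hQ)))) := by
  -- The group law depends on the instance, and the preceding results use the classical one.
  obtain rfl : ‹DecidableEq k› = fun a b => Classical.propDecidable (a = b) :=
    Subsingleton.elim _ _
  classical
  have hchar : ∀ p : ℕ, p.Prime → ringChar k ≠ p → (p : k) ≠ 0 := fun p hp hne h0 => by
    rcases (Nat.dvd_prime hp).mp ((ringChar.spec k p).mp h0) with h | h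
    · exact CharP.ringChar_ne_one h
    · exact hne h
  obtain ⟨hW₁, hW₂, hgen⟩ := hW.exists_eq hℓ.ne_zero
  have e₁ := (hh₁.isFun hℓ hW₁).eq_torsFun hh₁.ne_zero hW₁
  have e₂ := (hh₂.isFun hℓ hW₂).eq_torsFun hh₂.ne_zero hW₂
  simp only [value_eq_val, e₁, e₂]
  have key : (∃ P : E.toAffine.Point, ℓ • P = Q) →
      (∃ ω₁ : k, ω₁ ^ ℓ = val (-Q) (torsFun ℓ W₁)) ∧
      (∃ ω₂ : k, ω₂ ^ ℓ = val (-Q) (torsFun ℓ W₂)) := by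
    rintro ⟨P, rfl⟩
    exact ⟨⟨_, kummer_pow hh₁.ne_zero hW₁ hQ⟩, ⟨_, kummer_pow hh₂.ne_zero hW₂ hQ⟩⟩
  refine ⟨key, fun hQ₁ hQ₂ => ⟨key, ?_⟩⟩
  rintro ⟨⟨ω₁, hω₁⟩, ω₂, hω₂⟩
  exact exists_nsmul_eq_of_isPow (by exact_mod_cast hchar 2 Nat.prime_two hk2)
    (by exact_mod_cast hchar 3 Nat.prime_three hk3) hℓ (hchar ℓ hℓ hkℓ) hW₁ hW₂ hgen hQ hQ₁ hQ₂
    hω₁ hω₂
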